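/- Let $\mathbb K=\mathbb R$ or $\mathbb C$; all spaces are over $\mathbb K$, and $m\in\mathbb N$. For a normed space $E$, a Banach space $X$ and $1\le p<\infty$, let $\Pi_p({}^mE;X)$ be the set of continuous $m$-linear operators $T:E\times\cdots\times E\to X$ that are multiple $p$-summing, i.e. for which there is $C>0$ such that for all finite families $(x^k_{j})_{j=1}^{J_k}\subset E$, $k=1,\dots,m$, $$\Big(\sum_{j_1=1}^{J_1}\cdots\sum_{j_m=1}^{J_m}\|T(x^1_{j_1},\dots,x^m_{j_m})\|_X^p\Big)^{1/p}\le C\prod_{k=1}^m w_p\big((x^k_{j})_{j}\big),\qquad w_p\big((y_j)_j\big)=\sup_{\gamma\in B_{E'}}\Big(\sum_j|\gamma(y_j)|^p\Big)^{1/p},$$ where $B_{E'}$ is the closed unit ball of the dual of $E$. For $1\le r\le\infty$, a normed space $E$ is an $\mathcal L^g_r$-space if there is $\lambda\ge1$ such that for every finite-dimensional subspace $M\subset E$ and every $\varepsilon>0$ there are $n\in\mathbb N$ and linear operators $R:M\to\ell_r^n$ and $S:\ell_r^n\to E$ such that $S\circ R$ is the inclusion $M\hookrightarrow E$ and $\|S\|\,\|R\|\le\lambda+\varepsilon$.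 A Banach sequence space is a Banach space $X\subset\mathbb K^{\mathbb N}$ such that $\ell_1\subset X\subset\ell_\infty$ with inclusions of norm one, and such that if $x\in\mathbb K^{\mathbb N}$ and $y\in X$ satisfy $|x_n|\le|y_n|$ for all $n$, then $x\in X$ and $\|x\|_X\le\|y\|_X$. For $1\le q<\infty$ it is $q$-concave if there is $C>0$ such that for all finite families $x_1,\dots,x_n\in X$, $$\Big(\sum_{k=1}^n\|x_k\|_X^q\Big)^{1/q}\le C\,\Big\|\Big(\sum_{k=1}^n|x_k|^q\Big)^{1/q}\Big\|_X,$$ the expression inside the norm on the right being computed coordinatewise. **Corollary 2.8.** Let $1\le q\le s<\infty$, let $1\le r\le\infty$ with conjugate exponent $r'$ ($\frac1r+\frac1{r'}=1$), let $X$ be a $q$-concave Banach sequence space and let $E$ be an $\mathcal L^g_r$-space. If $s<r'<2$, or if $r=2$, then $$\Pi_s({}^mE;X)=\Pi_q({}^mE;X).$$ -/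

import Mathlib

open scoped ENNReal NNReal

noncomputable section

/-- The weak `ℓ_p`-norm of a finite family of vectors:
`w_p(x) = sup { (∑ j, |γ (x j)| ^ p) ^ (1 / p) : γ in the closed unit ball of the dual of E }`.
For `p > 0` the supremum is over a nonempty set that is bounded above. -/
def weakLpNorm (𝕜 : Type*) [RCLike 𝕜] {E : Type*} [NormedAddCommGroup E] [NormedSpace 𝕜 E]
    (p : ℝ) {J : ℕ} (x : Fin J → E) : ℝ :=
  ⨆ γ : Metric.closedBall (0 : StrongDual 𝕜 E) 1,
    (∑ j, ‖(γ : StrongDual 𝕜 E) (x j)‖ ^ p) ^ (1 / p)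

/-- The set `Π_p(^m E; F)` of multiple `p`-summing operators among the continuous `m`-linear
operators from `E × ⋯ × E` to `F`. The `k`-th family has its own length `J k`, and the sum runs
over all multi-indices `(j 0, …, j (m - 1))`. -/
def multipleSumming (𝕜 : Type*) [RCLike 𝕜] (m : ℕ) (E F : Type*)
    [NormedAddCommGroup E] [NormedSpace 𝕜 E] [NormedAddCommGroup F] [NormedSpace 𝕜 F] (p : ℝ) :
    Set (ContinuousMultilinearMap 𝕜 (fun _ : Fin m => E) F) :=
  {T | ∃ C : ℝ, 0 < C ∧ ∀ (J : Fin m → ℕ) (x : (k : Fin m) → Fin (J k) → E),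
    (∑ j : (k : Fin m) → Fin (J k), ‖T (fun k => x k (j k))‖ ^ p) ^ (1 / p)
      ≤ C * ∏ k, weakLpNorm 𝕜 p (x k)}

/-- `E` is an `𝓛^g_{r,lam}`-space: for each finite dimensional subspace `M` and each `ε > 0` the
inclusion of `M` into `E` factors as `S ∘ R` through some `ℓ_r^n`, with
`‖S‖ * ‖R‖ ≤ lam + ε`. -/
def IsLgSpaceWith (𝕜 : Type*) [RCLike 𝕜] (r : ℝ≥0∞) [Fact (1 ≤ r)] (lam : ℝ)
    (E : Type*) [NormedAddCommGroup E] [NormedSpace 𝕜 E] : Prop :=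
  ∀ M : Submodule 𝕜 E, FiniteDimensional 𝕜 M → ∀ ε : ℝ, 0 < ε →
    ∃ (n : ℕ) (R : M →L[𝕜] PiLp r (fun _ : Fin n => 𝕜))
      (S : PiLp r (fun _ : Fin n => 𝕜) →L[𝕜] E),
      S.comp R = M.subtypeL ∧ ‖S‖ * ‖R‖ ≤ lam + ε

/-- `E` is an `𝓛^g_r`-space: it is an `𝓛^g_{r,lam}`-space for some `lam ≥ 1`. -/
def IsLgSpace (𝕜 : Type*) [RCLike 𝕜] (r : ℝ≥0∞) [Fact (1 ≤ r)]
    (E : Type*) [NormedAddCommGroup E] [NormedSpace 𝕜 E] : Prop :=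
  ∃ lam : ℝ, 1 ≤ lam ∧ IsLgSpaceWith 𝕜 r lam E

/-- The Banach space `X`, regarded as a space of scalar sequences through the injective linear map
`ι` that sends an element of `X` to the sequence of its coordinates, is a Banach sequence space:
`ℓ_1 ⊆ X ⊆ ℓ_∞` with inclusions of norm one, and `X` is solid with monotone norm. (The two bounds
`‖x‖_∞ ≤ ‖x‖_X ≤ ‖x‖_1` force both inclusions to have norm exactly one, as unit vectors show.) -/
structure IsBanachSequenceSpace {𝕜 : Type*} [RCLike 𝕜] {X : Type*}
    [NormedAddCommGroup X] [NormedSpace 𝕜 X] [CompleteSpace X]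
    (ι : X →ₗ[𝕜] (ℕ → 𝕜)) : Prop where
  injective : Function.Injective ι
  l1_subset : ∀ x : ℕ → 𝕜, Summable (fun n => ‖x n‖) →
    ∃ y : X, ι y = x ∧ ‖y‖ ≤ ∑' n, ‖x n‖
  subset_linfty : ∀ (y : X) (n : ℕ), ‖ι y n‖ ≤ ‖y‖
  solid : ∀ (x : ℕ → 𝕜) (y : X), (∀ n, ‖x n‖ ≤ ‖ι y n‖) →
    ∃ z : X, ι z = x ∧ ‖z‖ ≤ ‖y‖

/-- `q`-concavity (for `q ≥ 1`) of the sequence space `X` with coordinate map `ι`. The element `y`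
is the sequence `(∑ k, |x k| ^ q) ^ (1 / q)`, computed coordinatewise; in a Banach sequence space
it always exists and is unique. -/
def IsQConcave {𝕜 : Type*} [RCLike 𝕜] {X : Type*}
    [NormedAddCommGroup X] [NormedSpace 𝕜 X] (ι : X →ₗ[𝕜] (ℕ → 𝕜)) (q : ℝ) : Prop :=
  ∃ C : ℝ, 0 < C ∧ ∀ (n : ℕ) (x : Fin n → X), ∃ y : X,
    (∀ i, ι y i = (((∑ k, ‖ι (x k) i‖ ^ q) ^ (1 / q) : ℝ) : 𝕜)) ∧
      (∑ k, ‖x k‖ ^ q) ^ (1 / q) ≤ C * ‖y‖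

end

/-! The dual of `ℓ_r^n` is `ℓ_{r'}^n`. If `p < r' < 2` or `r = 2`, it embeds into a space of random
variables whose `L_1` norm bounds the dual norm from above and whose `L_p` norm is bounded by it,
with constants independent of `n`. The classical embedding uses stable or Gaussian variables. Finite
substitutes serve here: random signs for `r = 2`, random signs times power-law coordinates
otherwise. Each gives a finite family `θ` in `ℓ_r^n` satisfying `IsDualSampling`.

A functional is then controlled by its mean modulus over `θ`. Iterating over the `m` variables,
every scalar `m`-linear form satisfies an `s`-summing inequality whose constant is `A ^ m` times its
mean modulus over the points of `θ` (`sum_norm_rpow_le_of_lower`). Applied to each coordinate of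
`T`, this is an inequality between sequences, which `s`-concavity and solidity turn into a bound by
the mean of `‖T(θ)‖`. That mean is at most the `p`-mean, which is bounded by testing `p`-summability
on `θ` itself (`sum_norm_le_of_upper`).

Hence `p`-summing implies `s`-summing whenever `X` is `s`-concave and samplings in `L_p` exist, with
no order required between `p` and `s` (`multipleSumming_subset`). Since `q`-concavity implies
`s`-concavity (`IsQConcave.mono`), this applies in both directions. -/

/-- Minkowski's inequality for a finite sum of nonnegative families. -/
theorem Lp_sum_le_of_nonneg {ι κ : Type*} (s : Finset ι) (t : Finset κ) {f : ι → κ → ℝ} {p : ℝ}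
    (hp : 1 ≤ p) (hf : ∀ i k, 0 ≤ f i k) :
    (∑ i ∈ s, (∑ k ∈ t, f i k) ^ p) ^ (1 / p) ≤ ∑ k ∈ t, (∑ i ∈ s, f i k ^ p) ^ (1 / p) := by
  classical
  have hp0 : p ≠ 0 := by linarith
  induction t using Finset.induction_on with
  | empty => simp [Real.zero_rpow hp0, Real.zero_rpow (inv_ne_zero hp0)]
  | insert a t ha ih =>
    simp only [Finset.sum_insert ha]
    refine (Real.Lp_add_le_of_nonneg s hp (fun i _ => hf i a)
      fun i _ => Finset.sum_nonneg fun k _ => hf i k).trans ?_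
    gcongr

/-! ### Weak norms under functionals, operators and subspaces. -/

section weakLpNorm

variable {𝕜 : Type*} [RCLike 𝕜] {E F : Type*} [NormedAddCommGroup E] [NormedSpace 𝕜 E]
  [NormedAddCommGroup F] [NormedSpace 𝕜 F]

theorem weakLpNorm_nonneg (p : ℝ) {J : ℕ} (x : Fin J → E) : 0 ≤ weakLpNorm 𝕜 p x :=
  Real.iSup_nonneg fun _ => by positivity

theorem le_weakLpNorm {p : ℝ} (hp : 0 < p) {J : ℕ} (x : Fin J → E) (γ : StrongDual 𝕜 E)
    (hγ : ‖γ‖ ≤ 1) : (∑ j, ‖γ (x j)‖ ^ p) ^ (1 / p) ≤ weakLpNorm 𝕜 p x := by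
  refine le_ciSup (f := fun γ : Metric.closedBall (0 : StrongDual 𝕜 E) 1 =>
    (∑ j, ‖(γ : StrongDual 𝕜 E) (x j)‖ ^ p) ^ (1 / p)) ⟨(∑ j, ‖x j‖ ^ p) ^ (1 / p), ?_⟩
    ⟨γ, by simpa using hγ⟩
  rintro _ ⟨⟨δ, hδ⟩, rfl⟩
  have h1 : ‖δ‖ ≤ 1 := by simpa using hδ
  have (j : Fin J) : ‖δ (x j)‖ ≤ ‖x j‖ := by
    simpa using δ.le_of_opNorm_le h1 (x j)
  dsimp only
  gcongr
  exact this _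

theorem weakLpNorm_le {p : ℝ} {J : ℕ} (x : Fin J → E) {B : ℝ}
    (h : ∀ γ : StrongDual 𝕜 E, ‖γ‖ ≤ 1 → (∑ j, ‖γ (x j)‖ ^ p) ^ (1 / p) ≤ B) :
    weakLpNorm 𝕜 p x ≤ B := by
  have : Nonempty (Metric.closedBall (0 : StrongDual 𝕜 E) 1) := ⟨⟨0, by simp⟩⟩
  exact ciSup_le fun γ => h γ (mem_closedBall_zero_iff.mp γ.2)

theorem le_norm_mul_weakLpNorm {p : ℝ} (hp : 0 < p) {J : ℕ} (x : Fin J → E)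
    (γ : StrongDual 𝕜 E) :
    (∑ j, ‖γ (x j)‖ ^ p) ^ (1 / p) ≤ ‖γ‖ * weakLpNorm 𝕜 p x := by
  rcases eq_or_ne γ 0 with rfl | hγ
  · simp [Real.zero_rpow hp.ne', Real.zero_rpow (inv_ne_zero hp.ne')]
  have h0 : 0 < ‖γ‖ := norm_pos_iff.mpr hγ
  have h := le_weakLpNorm hp x (((‖γ‖⁻¹ : ℝ) : 𝕜) • γ) (by simp [norm_smul, h0.ne'])
  have h2 (j : Fin J) : ‖γ (x j)‖ ^ p = ‖γ‖ ^ p * ‖(((‖γ‖⁻¹ : ℝ) : 𝕜) • γ) (x j)‖ ^ p := by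
    rw [← Real.mul_rpow (by positivity) (by positivity)]
    congr 1
    simp [h0.ne']
  simp_rw [h2]
  rw [← Finset.mul_sum, Real.mul_rpow (by positivity) (by positivity), ← Real.rpow_mul h0.le,
    mul_one_div_cancel hp.ne', Real.rpow_one]
  gcongr

theorem weakLpNorm_map_le {p : ℝ} (hp : 0 < p) {J : ℕ} (x : Fin J → E) (S : E →L[𝕜] F) :
    weakLpNorm 𝕜 p (fun j => S (x j)) ≤ ‖S‖ * weakLpNorm 𝕜 p x := by
  refine weakLpNorm_le _ fun γ hγ => (le_norm_mul_weakLpNorm hp x (γ.comp S)).trans ?_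
  gcongr
  · exact weakLpNorm_nonneg p x
  · exact (γ.opNorm_comp_le S).trans (by nlinarith [norm_nonneg S])

/-- Enlarging the space does not increase the weak norm of a family. -/
theorem weakLpNorm_subtype_le {p : ℝ} (hp : 0 < p) {J : ℕ} (M : Submodule 𝕜 E) (x : Fin J → M) :
    weakLpNorm 𝕜 p x ≤ weakLpNorm 𝕜 p (fun j => (x j : E)) := by
  refine weakLpNorm_le _ fun γ hγ => ?_
  obtain ⟨δ, hδ, hn⟩ := exists_extension_norm_eq M γ
  simp_rw [← hδ]
  exact le_weakLpNorm hp _ δ (hn.trans_le hγ)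

end weakLpNorm

/-! ### Samplings of a dual space and multilinear maps. -/

/-- The finite family `θ` in `F`, with the uniform distribution, embeds the dual of `F`
isomorphically into `L_1` with lower constant `A⁻¹`, and into `L_p` with norm at most `B`. -/
structure IsDualSampling (𝕜 : Type*) [RCLike 𝕜] {F : Type*} [NormedAddCommGroup F]
    [NormedSpace 𝕜 F] (p A B : ℝ) {L : ℕ} (θ : Fin L → F) : Prop where
  pos : 0 < L
  lower : ∀ γ : StrongDual 𝕜 F, ‖γ‖ ≤ A * ∑ ω, ‖γ (θ ω)‖ * (L : ℝ)⁻¹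
  upper : ∀ γ : StrongDual 𝕜 F, (∑ ω, ‖γ (θ ω)‖ ^ p * (L : ℝ)⁻¹) ^ (1 / p) ≤ B * ‖γ‖

section scalar

variable {𝕜 : Type*} [RCLike 𝕜] {F : Type*} [NormedAddCommGroup F] [NormedSpace 𝕜 F]

theorem Fin.sum_pi_succ {m : ℕ} {α : Fin (m + 1) → Type*} [∀ k, Fintype (α k)]
    {M : Type*} [AddCommMonoid M] (f : (∀ k, α k) → M) :
    ∑ j, f j = ∑ j' : ∀ k : Fin m, α k.succ, ∑ a : α 0, f (Fin.cons a j') := by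
  rw [← Equiv.sum_comp (Fin.consEquiv α), Fintype.sum_prod_type_right]
  rfl

/-- Induction on `m`. With all variables but the first frozen, `τ` is a functional, whose `ℓ_p` sum
over `y 0` is at most its norm times the weak norm; the sampling replaces the norm by a mean over
`θ`. Minkowski moves this mean outside the remaining `ℓ_p` sum, and the induction hypothesis applies
to each `τ.curryLeft (θ ω)`. -/
theorem sum_norm_rpow_le_of_lower {p A : ℝ} (hp : 1 ≤ p) (hA : 0 ≤ A) {L : ℕ} {θ : Fin L → F}
    (hθ : ∀ γ : StrongDual 𝕜 F, ‖γ‖ ≤ A * ∑ ω, ‖γ (θ ω)‖ * (L : ℝ)⁻¹) (m : ℕ)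
    (τ : ContinuousMultilinearMap 𝕜 (fun _ : Fin m => F) 𝕜) (J : Fin m → ℕ)
    (y : (k : Fin m) → Fin (J k) → F) :
    (∑ j : (k : Fin m) → Fin (J k), ‖τ (fun k => y k (j k))‖ ^ p) ^ (1 / p)
      ≤ A ^ m * (∏ k, weakLpNorm 𝕜 p (y k)) *
        ∑ ω : Fin m → Fin L, ‖τ (fun k => θ (ω k))‖ * ((L : ℝ)⁻¹) ^ m := by
  have hp0 : 0 < p := by linarith
  induction m with
  | zero =>
    simp only [Finset.univ_unique, Finset.sum_singleton, Finset.univ_eq_empty, Finset.prod_empty,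
      pow_zero, mul_one, one_mul]
    rw [← Real.rpow_mul (norm_nonneg _), mul_one_div_cancel hp0.ne', Real.rpow_one]
    exact (congrArg (fun v => ‖τ v‖) (Subsingleton.elim _ _)).le
  | succ m ih =>
    rw [Fin.sum_pi_succ]
    set w := weakLpNorm 𝕜 p (y 0) with hw
    have hw0 : 0 ≤ w := weakLpNorm_nonneg p _
    have hcons (a : Fin (J 0)) (j' : ∀ k : Fin m, Fin (J k.succ)) :
        τ (fun k => y k ((Fin.cons a j' : ∀ k, Fin (J k)) k))
          = τ.curryLeft (y 0 a) (fun k => y k.succ (j' k)) := by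
      rw [ContinuousMultilinearMap.curryLeft_apply]
      congr 1
      ext k
      refine Fin.cases ?_ (fun i => ?_) k <;> simp
    simp_rw [hcons]
    have hpart (j' : ∀ k : Fin m, Fin (J k.succ)) :
        ∑ a : Fin (J 0), ‖τ.curryLeft (y 0 a) (fun k => y k.succ (j' k))‖ ^ p
          ≤ (∑ ω, w * A * (L : ℝ)⁻¹ *
              ‖τ.curryLeft (θ ω) (fun k => y k.succ (j' k))‖) ^ p := by
      let γ : StrongDual 𝕜 F :=
        (ContinuousMultilinearMap.apply 𝕜 (fun _ : Fin m => F) 𝕜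
          (fun k => y k.succ (j' k))).comp τ.curryLeft
      have h1 := le_norm_mul_weakLpNorm hp0 (y 0) γ
      have h2 : (∑ a, ‖γ (y 0 a)‖ ^ p) ^ (1 / p) ≤
          ∑ ω, w * A * (L : ℝ)⁻¹ * ‖γ (θ ω)‖ := by
        refine h1.trans ((mul_le_mul_of_nonneg_right (hθ γ) hw0).trans_eq ?_)
        rw [Finset.mul_sum, Finset.sum_mul]
        exact Finset.sum_congr rfl fun ω _ => by ring
      have h3 := Real.rpow_le_rpow (by positivity) h2 hp0.le
      rwa [← Real.rpow_mul (by positivity), one_div_mul_cancel hp0.ne', Real.rpow_one] at h3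
    calc _ ≤ (∑ j' : ∀ k : Fin m, Fin (J k.succ), (∑ ω, w * A * (L : ℝ)⁻¹ *
              ‖τ.curryLeft (θ ω) (fun k => y k.succ (j' k))‖) ^ p) ^ (1 / p) := by
            gcongr
            exact hpart _
      _ ≤ ∑ ω, (∑ j' : ∀ k : Fin m, Fin (J k.succ), (w * A * (L : ℝ)⁻¹ *
              ‖τ.curryLeft (θ ω) (fun k => y k.succ (j' k))‖) ^ p) ^ (1 / p) :=
            Lp_sum_le_of_nonneg _ _ hp fun _ _ => by positivity
      _ = ∑ ω, w * A * (L : ℝ)⁻¹ * (∑ j' : ∀ k : Fin m, Fin (J k.succ),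
              ‖τ.curryLeft (θ ω) (fun k => y k.succ (j' k))‖ ^ p) ^ (1 / p) := by
            refine Finset.sum_congr rfl fun ω _ => ?_
            have hc : 0 ≤ w * A * (L : ℝ)⁻¹ := by positivity
            simp_rw [Real.mul_rpow hc (norm_nonneg _)]
            rw [← Finset.mul_sum, Real.mul_rpow (by positivity) (by positivity),
              ← Real.rpow_mul hc, mul_one_div_cancel hp0.ne', Real.rpow_one]
      _ ≤ ∑ ω, w * A * (L : ℝ)⁻¹ * (A ^ m * (∏ k : Fin m, weakLpNorm 𝕜 p (y k.succ)) *
            ∑ ω' : Fin m → Fin L, ‖τ.curryLeft (θ ω) (fun k => θ (ω' k))‖ * ((L : ℝ)⁻¹) ^ m) := by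
            gcongr with ω
            exact ih (τ.curryLeft (θ ω)) (fun k => J k.succ) (fun k => y k.succ)
      _ = _ := by
            rw [Fin.sum_pi_succ (fun ω : Fin (m + 1) → Fin L => _), Finset.sum_comm,
              Fin.prod_univ_succ, Finset.mul_sum]
            refine Finset.sum_congr rfl fun ω _ => ?_
            simp_rw [Finset.mul_sum]
            refine Finset.sum_congr rfl fun ω' _ => ?_
            have : (fun k => θ ((Fin.cons ω ω' : Fin (m + 1) → Fin L) k))
                = Fin.cons (θ ω) (fun k => θ (ω' k)) := by
              ext k
              refine Fin.cases ?_ (fun i => ?_) k <;> simp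
            rw [this, ContinuousMultilinearMap.curryLeft_apply]
            ring

end scalar

/-- The mean is at most the `p`-mean, and `hK` bounds the latter. The upper sampling estimate gives
`θ` weak norm at most `L ^ (1 / p) * B`, and the powers of `L` cancel against the normalisation of
the mean. -/
theorem sum_norm_le_of_upper {𝕜 : Type*} [RCLike 𝕜] {X F : Type*} [NormedAddCommGroup X]
    [NormedSpace 𝕜 X] [NormedAddCommGroup F] [NormedSpace 𝕜 F]
    {p A B : ℝ} (hp : 1 ≤ p) {L : ℕ} {θ : Fin L → F}
    (hθ : IsDualSampling 𝕜 p A B θ) (hB : 0 ≤ B) {m : ℕ} {K : ℝ} (hK0 : 0 ≤ K)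
    (T : ContinuousMultilinearMap 𝕜 (fun _ : Fin m => F) X)
    (hK : (∑ ω : Fin m → Fin L, ‖T (fun k => θ (ω k))‖ ^ p) ^ (1 / p)
      ≤ K * ∏ _k : Fin m, weakLpNorm 𝕜 p θ) :
    ∑ ω : Fin m → Fin L, ‖T (fun k => θ (ω k))‖ * ((L : ℝ)⁻¹) ^ m ≤ K * B ^ m := by
  have hp0 : 0 < p := by linarith
  have hL : (0 : ℝ) < L := by exact_mod_cast hθ.pos
  have hw : weakLpNorm 𝕜 p θ ≤ (L : ℝ) ^ (1 / p) * B := by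
    refine weakLpNorm_le _ fun γ hγ => ?_
    have h1 := hθ.upper γ
    rw [← Finset.sum_mul, Real.mul_rpow (by positivity) (by positivity), Real.inv_rpow hL.le,
      ← div_eq_mul_inv, div_le_iff₀ (by positivity)] at h1
    refine h1.trans ?_
    rw [mul_comm]
    gcongr
    nlinarith
  have hsum : ∑ _ω : Fin m → Fin L, ((L : ℝ)⁻¹) ^ m = 1 := by
    simp [hL.ne']
  calc _ = ∑ ω : Fin m → Fin L, ((L : ℝ)⁻¹) ^ m * ‖T (fun k => θ (ω k))‖ := by
        simp_rw [mul_comm]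
    _ ≤ (∑ ω : Fin m → Fin L, ((L : ℝ)⁻¹) ^ m * ‖T (fun k => θ (ω k))‖ ^ p) ^ (1 / p) :=
        Real.arith_mean_le_rpow_mean _ _ _ (fun _ _ => by positivity) hsum
          (fun _ _ => norm_nonneg _) hp
    _ = (((L : ℝ)⁻¹) ^ m) ^ (1 / p) *
          (∑ ω : Fin m → Fin L, ‖T (fun k => θ (ω k))‖ ^ p) ^ (1 / p) := by
        rw [← Finset.mul_sum, Real.mul_rpow (by positivity) (by positivity)]
    _ ≤ (((L : ℝ)⁻¹) ^ m) ^ (1 / p) * (K * ((L : ℝ) ^ (1 / p) * B) ^ m) := by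
        gcongr
        refine hK.trans ?_
        rw [Finset.prod_const, Finset.card_univ, Fintype.card_fin]
        gcongr
        exact weakLpNorm_nonneg p θ
    _ = K * B ^ m := by
        have : (((L : ℝ)⁻¹) ^ m) ^ (1 / p) * ((L : ℝ) ^ (1 / p)) ^ m = 1 := by
          rw [← Real.rpow_natCast, ← Real.rpow_natCast, ← Real.rpow_mul (by positivity),
            ← Real.rpow_mul hL.le, Real.inv_rpow hL.le, mul_comm (m : ℝ)]
          exact inv_mul_cancel₀ (by positivity)
        rw [mul_pow]
        linear_combination (K * B ^ m) * this

/-! ### Concavity and the transfer from `p`-summing to `s`-summing. -/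

section sequenceSpace

variable {𝕜 : Type*} [RCLike 𝕜] {X : Type*} [NormedAddCommGroup X] [NormedSpace 𝕜 X]
  [CompleteSpace X] {ι : X →ₗ[𝕜] (ℕ → 𝕜)}

theorem IsBanachSequenceSpace.norm_le_norm (hX : IsBanachSequenceSpace ι) {x y : X}
    (h : ∀ n, ‖ι x n‖ ≤ ‖ι y n‖) : ‖x‖ ≤ ‖y‖ := by
  obtain ⟨z, hz, hzy⟩ := hX.solid (ι x) y h
  rwa [hX.injective hz] at hzy

/-- A finite nonnegative combination of absolute values lies in the sequence space, and its norm
obeys the triangle inequality. -/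
theorem IsBanachSequenceSpace.exists_sum_abs (hX : IsBanachSequenceSpace ι) {Ω : Type*}
    (s : Finset Ω) (x : Ω → X) {c : ℝ} (hc : 0 ≤ c) :
    ∃ z : X, (∀ n, ι z n = ((∑ ω ∈ s, ‖ι (x ω) n‖ * c : ℝ) : 𝕜)) ∧
      ‖z‖ ≤ ∑ ω ∈ s, ‖x ω‖ * c := by
  have habs (ω : Ω) : ∃ z : X, ι z = (fun n => ((‖ι (x ω) n‖ : ℝ) : 𝕜)) ∧ ‖z‖ ≤ ‖x ω‖ :=
    hX.solid _ (x ω) fun n => by simp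
  choose z hz hzx using habs
  refine ⟨∑ ω ∈ s, (c : 𝕜) • z ω, fun n => ?_, (norm_sum_le _ _).trans ?_⟩
  · simp [hz, mul_comm]
  · refine Finset.sum_le_sum fun ω _ => ?_
    rw [norm_smul, RCLike.norm_ofReal, abs_of_nonneg hc, mul_comm]
    exact mul_le_mul_of_nonneg_right (hzx ω) hc

/-- Apply `q`-concavity to reweighted vectors, then remove the weights in each coordinate by Hölder
with exponents `s / q` and `s / (s - q)`. -/
theorem IsQConcave.mono (hX : IsBanachSequenceSpace ι) {q s : ℝ} (hq : 1 ≤ q) (hqs : q ≤ s)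
    (h : IsQConcave ι q) : IsQConcave ι s := by
  rcases hqs.eq_or_lt with rfl | hlt
  · exact h
  have hq0 : 0 < q := by linarith
  have hs0 : 0 < s := by linarith
  obtain ⟨C, hC, h⟩ := h
  refine ⟨C, hC, fun n x => ?_⟩
  obtain ⟨v, hv, -⟩ := hX.exists_sum_abs Finset.univ x zero_le_one
  -- Domination by the sum of moduli, which lies in `X`, shows through solidity that the `ℓ_s` root
  -- lies in `X`.
  have hroot_le (i : ℕ) : (∑ k, ‖ι (x k) i‖ ^ s) ^ (1 / s) ≤ ∑ k, ‖ι (x k) i‖ := by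
    have h1 : ∑ k, ‖ι (x k) i‖ ^ s ≤ (∑ k, ‖ι (x k) i‖) ^ s := by
      have hS : 0 ≤ ∑ k, ‖ι (x k) i‖ := by positivity
      calc ∑ k, ‖ι (x k) i‖ ^ s ≤ ∑ k, ‖ι (x k) i‖ * (∑ k, ‖ι (x k) i‖) ^ (s - 1) := by
            refine Finset.sum_le_sum fun k _ => ?_
            have e : s = 1 + (s - 1) := by ring
            rw [show ‖ι (x k) i‖ ^ s = ‖ι (x k) i‖ ^ (1 + (s - 1)) by rw [← e],
              Real.rpow_add_of_nonneg (norm_nonneg _) zero_le_one (by linarith), Real.rpow_one]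
            gcongr
            · linarith
            · exact Finset.single_le_sum (f := fun k => ‖ι (x k) i‖)
                (fun _ _ => norm_nonneg _) (Finset.mem_univ k)
        _ = (∑ k, ‖ι (x k) i‖) ^ (1 + (s - 1)) := by
            rw [← Finset.sum_mul, Real.rpow_add_of_nonneg hS zero_le_one (by linarith),
              Real.rpow_one]
        _ = _ := by ring_nf
    calc _ ≤ ((∑ k, ‖ι (x k) i‖) ^ s) ^ (1 / s) := by gcongr
      _ = _ := by
        rw [← Real.rpow_mul (by positivity), mul_one_div_cancel hs0.ne', Real.rpow_one]
  obtain ⟨y, hy, -⟩ := hX.solid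
    (fun i => (((∑ k, ‖ι (x k) i‖ ^ s) ^ (1 / s) : ℝ) : 𝕜)) v fun i => by
      rw [hv, RCLike.norm_ofReal, RCLike.norm_ofReal, abs_of_nonneg (by positivity),
        abs_of_nonneg (by positivity)]
      simpa using hroot_le i
  refine ⟨y, fun i => congrFun hy i, ?_⟩
  -- The weights are chosen so that `(b k * ‖x k‖) ^ q = ‖x k‖ ^ s`.
  set b : Fin n → ℝ := fun k => ‖x k‖ ^ ((s - q) / q) with hb
  have hb0 (k : Fin n) : 0 ≤ b k := by positivity
  set N : ℝ := ∑ k, ‖x k‖ ^ s with hN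
  have hN0 : 0 ≤ N := by positivity
  obtain ⟨z, hz, hzC⟩ := h n fun k => (b k : 𝕜) • x k
  have hpow (t : ℝ) (ht : 0 ≤ t) : t ^ q * (t ^ ((s - q) / q)) ^ q = t ^ s := by
    rw [← Real.rpow_mul ht, div_mul_cancel₀ _ hq0.ne',
      ← Real.rpow_add_of_nonneg ht hq0.le (by linarith)]
    ring_nf
  have hlhs : ∑ k, ‖(b k : 𝕜) • x k‖ ^ q = N := by
    refine Finset.sum_congr rfl fun k _ => ?_
    rw [norm_smul, RCLike.norm_ofReal, abs_of_nonneg (hb0 k), mul_comm,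
      Real.mul_rpow (norm_nonneg _) (hb0 k), hpow _ (norm_nonneg _)]
  have hconj : (s / q).HolderConjugate (s / (s - q)) := by
    rw [Real.holderConjugate_iff]
    have : s - q ≠ 0 := by linarith
    refine ⟨(one_lt_div hq0).2 hlt, ?_⟩
    field_simp
    ring
  have hzy : ‖z‖ ≤ N ^ ((s - q) / (s * q)) * ‖y‖ := by
    have : ‖z‖ ≤ ‖((N ^ ((s - q) / (s * q)) : ℝ) : 𝕜) • y‖ := by
      refine hX.norm_le_norm fun i => ?_
      have hyi : ι y i = (((∑ k, ‖ι (x k) i‖ ^ s) ^ (1 / s) : ℝ) : 𝕜) := congrFun hy i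
      rw [hz, map_smul, Pi.smul_apply, smul_eq_mul, hyi, ← RCLike.ofReal_mul, RCLike.norm_ofReal,
        RCLike.norm_ofReal, abs_of_nonneg (by positivity), abs_of_nonneg (by positivity)]
      have hH : ∑ k, ‖ι ((b k : 𝕜) • x k) i‖ ^ q
          ≤ (∑ k, ‖ι (x k) i‖ ^ s) ^ (q / s) * N ^ ((s - q) / s) := by
        have := Real.inner_le_Lp_mul_Lq_of_nonneg Finset.univ hconj
          (f := fun k => ‖ι (x k) i‖ ^ q) (g := fun k => b k ^ q)
          (fun _ _ => by positivity) fun _ _ => by positivity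
        convert this using 1
        · refine Finset.sum_congr rfl fun k _ => ?_
          rw [map_smul, Pi.smul_apply, norm_smul, RCLike.norm_ofReal, abs_of_nonneg (hb0 k),
            mul_comm, Real.mul_rpow (norm_nonneg _) (hb0 k)]
        · congr 2
          · refine Finset.sum_congr rfl fun k _ => ?_
            rw [← Real.rpow_mul (norm_nonneg _), mul_div_cancel₀ _ hq0.ne']
          · rw [one_div_div]
          · refine Finset.sum_congr rfl fun k _ => ?_
            have : s - q ≠ 0 := by linarith
            rw [hb, ← Real.rpow_mul (norm_nonneg _), ← Real.rpow_mul (norm_nonneg _)]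
            congr 1
            field_simp
          · rw [one_div_div]
      calc _ ≤ ((∑ k, ‖ι (x k) i‖ ^ s) ^ (q / s) * N ^ ((s - q) / s)) ^ (1 / q) := by gcongr
        _ = _ := by
          rw [Real.mul_rpow (by positivity) (by positivity), ← Real.rpow_mul (by positivity),
            ← Real.rpow_mul hN0, mul_comm]
          congr 2 <;> field_simp
    refine this.trans_eq ?_
    rw [norm_smul, RCLike.norm_ofReal, abs_of_nonneg (by positivity)]
  rw [hlhs] at hzC
  rcases hN0.eq_or_lt with h0 | hpos
  · rw [← h0, Real.zero_rpow (by positivity)]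
    positivity
  -- The Hölder factor cancels because `1 / q = (s - q) / (s * q) + 1 / s`.
  have hfin : N ^ ((s - q) / (s * q)) * N ^ (1 / s) ≤ N ^ ((s - q) / (s * q)) * (C * ‖y‖) := by
    rw [← Real.rpow_add hpos]
    calc _ = N ^ (1 / q) := by
          congr 1
          field_simp
          ring
      _ ≤ C * ‖z‖ := hzC
      _ ≤ C * (N ^ ((s - q) / (s * q)) * ‖y‖) := by gcongr
      _ = _ := by ring
  exact le_of_mul_le_mul_left hfin (by positivity)

variable {F : Type*} [NormedAddCommGroup F] [NormedSpace 𝕜 F]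

/-- The scalar estimate, used at exponent `s` on every coordinate of `T`, dominates the `ℓ_s` root
`u` by a multiple of the mean `z` of the moduli of `T` over the sampling. Concavity passes from the
vectors to `u`, monotonicity from `u` to `z`, and the `p`-summing bound controls `z`. -/
theorem sum_norm_rpow_le_of_isDualSampling (hX : IsBanachSequenceSpace ι) {p s A B C : ℝ}
    (hp : 1 ≤ p) (hs : 1 ≤ s) (hA : 0 ≤ A) (hB : 0 ≤ B) (hC : 0 ≤ C)
    (hconc : ∀ (n : ℕ) (x : Fin n → X), ∃ y : X,
      (∀ i, ι y i = (((∑ k, ‖ι (x k) i‖ ^ s) ^ (1 / s) : ℝ) : 𝕜)) ∧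
        (∑ k, ‖x k‖ ^ s) ^ (1 / s) ≤ C * ‖y‖)
    {L : ℕ} {θ : Fin L → F} (hθ : IsDualSampling 𝕜 p A B θ) {m : ℕ} {K : ℝ} (hK0 : 0 ≤ K)
    (T : ContinuousMultilinearMap 𝕜 (fun _ : Fin m => F) X)
    (hK : ∀ (J : Fin m → ℕ) (x : (k : Fin m) → Fin (J k) → F),
      (∑ j : (k : Fin m) → Fin (J k), ‖T (fun k => x k (j k))‖ ^ p) ^ (1 / p)
        ≤ K * ∏ k, weakLpNorm 𝕜 p (x k))
    (J : Fin m → ℕ) (y : (k : Fin m) → Fin (J k) → F) :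
    (∑ j : (k : Fin m) → Fin (J k), ‖T (fun k => y k (j k))‖ ^ s) ^ (1 / s)
      ≤ C * (A ^ m * (∏ k, weakLpNorm 𝕜 s (y k)) * (K * B ^ m)) := by
  obtain ⟨z, hz, hzle⟩ := hX.exists_sum_abs Finset.univ
    (fun ω : Fin m → Fin L => T (fun k => θ (ω k))) (c := ((L : ℝ)⁻¹) ^ m) (by positivity)
  have hz' := hzle.trans (sum_norm_le_of_upper hp hθ hB hK0 T (hK (fun _ => L) fun _ => θ))
  let e := (Fintype.equivFin ((k : Fin m) → Fin (J k))).symm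
  obtain ⟨u, hu, hule⟩ := hconc _ fun a => T (fun k => y k (e a k))
  rw [Equiv.sum_comp e (fun j => ‖T (fun k => y k (j k))‖ ^ s)] at hule
  set W := ∏ k, weakLpNorm 𝕜 s (y k) with hW
  have hW0 : 0 ≤ W := Finset.prod_nonneg fun k _ => weakLpNorm_nonneg s _
  have huz : ‖u‖ ≤ ‖((A ^ m * W : ℝ) : 𝕜) • z‖ := by
    refine hX.norm_le_norm fun i => ?_
    have hcont : Continuous fun x : X => ι x i := by
      refine AddMonoidHomClass.continuous_of_bound
        ((LinearMap.proj i : (ℕ → 𝕜) →ₗ[𝕜] 𝕜).comp ι) 1 fun x => ?_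
      simpa using hX.subset_linfty x i
    let φ : X →L[𝕜] 𝕜 := ⟨(LinearMap.proj i : (ℕ → 𝕜) →ₗ[𝕜] 𝕜).comp ι, hcont⟩
    have := sum_norm_rpow_le_of_lower hs hA hθ.lower m (φ.compContinuousMultilinearMap T) J y
    rw [hu, map_smul, Pi.smul_apply, smul_eq_mul, hz, ← RCLike.ofReal_mul, RCLike.norm_ofReal,
      RCLike.norm_ofReal, abs_of_nonneg (by positivity), abs_of_nonneg (by positivity)]
    rw [Equiv.sum_comp e (fun j => ‖ι (T (fun k => y k (j k))) i‖ ^ s)]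
    exact this
  rw [norm_smul, RCLike.norm_ofReal, abs_of_nonneg (by positivity)] at huz
  refine hule.trans ?_
  gcongr
  exact huz.trans (by gcongr)

variable {E : Type*} [NormedAddCommGroup E] [NormedSpace 𝕜 E]

/-- If the duals of the spaces `ℓ_r^n` have uniform samplings in `L_p`, then multiple `p`-summing
operators on an `𝓛^g_r`-space with values in an `s`-concave sequence space are multiple
`s`-summing. -/
theorem multipleSumming_subset (hX : IsBanachSequenceSpace ι) {p s A B : ℝ}
    (hp : 1 ≤ p) (hs : 1 ≤ s) (hA : 0 ≤ A) (hB : 0 ≤ B) (hconc : IsQConcave ι s)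
    {r : ℝ≥0∞} [Fact (1 ≤ r)] (hE : IsLgSpace 𝕜 r E)
    (hsamp : ∀ n : ℕ, ∃ (L : ℕ) (θ : Fin L → PiLp r (fun _ : Fin n => 𝕜)),
      IsDualSampling 𝕜 p A B θ) (m : ℕ) :
    multipleSumming 𝕜 m E X p ⊆ multipleSumming 𝕜 m E X s := by
  rintro T ⟨K, hK0, hK⟩
  obtain ⟨C, hC, hconc⟩ := hconc
  obtain ⟨lam, hlam, hE⟩ := hE
  have hs0 : 0 < s := by linarith
  have hp0 : 0 < p := by linarith
  -- The term `lam + 1` comes from factoring with `ε = 1`. `D` may vanish, so `D + 1` serves as the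
  -- positive constant.
  set D : ℝ := C * (A ^ m * (lam + 1) ^ m * (K * B ^ m)) with hD
  have hD0 : 0 ≤ D := by positivity
  refine ⟨D + 1, by positivity, fun J x => ?_⟩
  have hW0 : 0 ≤ ∏ k, weakLpNorm 𝕜 s (x k) :=
    Finset.prod_nonneg fun k _ => weakLpNorm_nonneg s _
  refine le_trans ?_ (mul_le_mul_of_nonneg_right (le_add_of_nonneg_right zero_le_one) hW0)
  -- All `m` families lie in one finite-dimensional subspace, so a single factorisation serves every
  -- variable.
  let M : Submodule 𝕜 E := Submodule.span 𝕜 (Set.range fun i : Σ k, Fin (J k) => x i.1 i.2)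
  have hMfin : FiniteDimensional 𝕜 M := FiniteDimensional.span_of_finite 𝕜 (Set.finite_range _)
  obtain ⟨n, R, S, hSR, hnorm⟩ := hE M hMfin 1 one_pos
  obtain ⟨L, θ, hθ⟩ := hsamp n
  let x' : (k : Fin m) → Fin (J k) → M := fun k j =>
    ⟨x k j, Submodule.subset_span ⟨⟨k, j⟩, rfl⟩⟩
  have hx' (k : Fin m) (j : Fin (J k)) : S (R (x' k j)) = x k j := by
    rw [← ContinuousLinearMap.comp_apply, hSR]
    rfl
  have key := sum_norm_rpow_le_of_isDualSampling hX hp hs hA hB hC.le hconc hθ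
    (K := K * ‖S‖ ^ m) (by positivity) (T.compContinuousLinearMap fun _ => S)
    (fun J y => by
      refine (hK J fun k j => S (y k j)).trans ?_
      rw [mul_assoc]
      gcongr
      calc _ ≤ ∏ k, ‖S‖ * weakLpNorm 𝕜 p (y k) :=
            Finset.prod_le_prod (fun _ _ => weakLpNorm_nonneg _ _)
              fun k _ => weakLpNorm_map_le hp0 (y k) S
        _ = _ := by simp [Finset.prod_mul_distrib])
    J fun k j => R (x' k j)
  simp only [ContinuousMultilinearMap.compContinuousLinearMap_apply, hx'] at key
  refine key.trans ?_
  have hprod : ∏ k, weakLpNorm 𝕜 s (fun j => R (x' k j))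
      ≤ ‖R‖ ^ m * ∏ k, weakLpNorm 𝕜 s (x k) := by
    calc _ ≤ ∏ k, ‖R‖ * weakLpNorm 𝕜 s (x k) :=
          Finset.prod_le_prod (fun _ _ => weakLpNorm_nonneg _ _) fun k _ =>
            (weakLpNorm_map_le hs0 (x' k) R).trans
              (mul_le_mul_of_nonneg_left (weakLpNorm_subtype_le hs0 M (x' k)) (norm_nonneg R))
      _ = _ := by simp [Finset.prod_mul_distrib]
  calc _ ≤ C * (A ^ m * (‖R‖ ^ m * ∏ k, weakLpNorm 𝕜 s (x k)) * (K * ‖S‖ ^ m * B ^ m)) := by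
        gcongr
    _ = C * (A ^ m * (‖S‖ * ‖R‖) ^ m * (K * B ^ m)) * ∏ k, weakLpNorm 𝕜 s (x k) := by
        rw [mul_pow]
        ring
    _ ≤ _ := by
        rw [hD]
        gcongr

end sequenceSpace

/-! ### Khintchine's inequalities for random signs. -/

section Khintchine

/-- The sign `±1` attached to a Boolean. -/
def boolSign (b : Bool) : ℝ := if b then 1 else -1

theorem sum_boolSign_exp (t : ℝ) : ∑ b : Bool, Real.exp (boolSign b * t) = 2 * Real.cosh t := by
  simp [boolSign, Real.cosh_eq]
  ring

/-- Independence factors the exponential moment, and `cosh t ≤ exp (t ^ 2 / 2)` bounds each factor.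
-/
theorem sum_exp_sum_boolSign_le {n : ℕ} (a : Fin n → ℝ) :
    ∑ ε : Fin n → Bool, Real.exp (∑ i, boolSign (ε i) * a i)
      ≤ 2 ^ n * Real.exp ((∑ i, a i ^ 2) / 2) := by
  have h := Finset.prod_univ_sum (fun _ : Fin n => (Finset.univ : Finset Bool))
    fun i b => Real.exp (boolSign b * a i)
  simp only [Fintype.piFinset_univ, ← Real.exp_sum] at h
  rw [← h, Finset.sum_div, Real.exp_sum]
  simp_rw [sum_boolSign_exp]
  rw [Finset.prod_mul_distrib]
  simp only [Finset.prod_const, Finset.card_univ, Fintype.card_fin]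
  gcongr with i
  exact Real.cosh_le_exp_half_sq _

theorem sum_norm_sum_boolSign_sq {𝕜 : Type*} [RCLike 𝕜] {n : ℕ} (a : Fin n → 𝕜) :
    ∑ ε : Fin n → Bool, ‖∑ i, (boolSign (ε i) : 𝕜) * a i‖ ^ 2 = 2 ^ n * ∑ i, ‖a i‖ ^ 2 := by
  induction n with
  | zero => simp
  | succ n ih =>
    rw [Fin.sum_pi_succ]
    have h (ε : Fin n → Bool) :
        ∑ b : Bool, ‖∑ i, (boolSign ((Fin.cons b ε : Fin (n + 1) → Bool) i) : 𝕜) * a i‖ ^ 2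
          = 2 * ‖a 0‖ ^ 2 + 2 * ‖∑ i : Fin n, (boolSign (ε i) : 𝕜) * a i.succ‖ ^ 2 := by
      simp only [Fin.sum_univ_succ, Fin.cons_zero, Fin.cons_succ, Fintype.sum_bool]
      set S := ∑ i : Fin n, (boolSign (ε i) : 𝕜) * a i.succ
      have := parallelogram_law_with_norm 𝕜 S (a 0)
      simp only [boolSign, if_true, Bool.false_eq_true, if_false, RCLike.ofReal_one, one_mul,
        RCLike.ofReal_neg, neg_one_mul]
      rw [add_comm (a 0), neg_add_eq_sub]
      linarith
    simp_rw [h]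
    rw [Finset.sum_add_distrib, ← Finset.mul_sum Finset.univ
      (fun ε : Fin n → Bool => ‖∑ i : Fin n, (boolSign (ε i) : 𝕜) * a i.succ‖ ^ 2) 2, ih,
      Fin.sum_univ_succ]
    simp
    ring

/-- After normalising `a` in `ℓ_2`, the `p`-th power is dominated by exponentials, whose moments are
subgaussian. -/
theorem exists_sum_abs_rpow_boolSign_le {p : ℝ} (hp : 0 < p) :
    ∃ C : ℝ, 0 < C ∧ ∀ (n : ℕ) (a : Fin n → ℝ),
      ∑ ε : Fin n → Bool, |∑ i, boolSign (ε i) * a i| ^ p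
        ≤ 2 ^ n * (C * √(∑ i, a i ^ 2) ^ p) := by
  obtain ⟨k, hk⟩ := exists_nat_ge p
  refine ⟨1 + k.factorial * (2 * Real.exp (1 / 2)), by positivity, fun n a => ?_⟩
  set ρ := √(∑ i, a i ^ 2) with hρ
  have hρsq : ρ ^ 2 = ∑ i, a i ^ 2 := Real.sq_sqrt (by positivity)
  have hρ0 : 0 ≤ ρ := Real.sqrt_nonneg _
  rcases hρ0.eq_or_lt with h0 | hpos
  · have ha (i : Fin n) : a i = 0 := by
      have : ∑ i, a i ^ 2 = 0 := by rw [← hρsq, ← h0]; simp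
      simpa using (Finset.sum_eq_zero_iff_of_nonneg fun _ _ => sq_nonneg _).1 this i
    simp [ha, Real.zero_rpow hp.ne']
    positivity
  have hone : ∑ i, (a i / ρ) ^ 2 = 1 := by
    simp_rw [div_pow]
    rw [← Finset.sum_div, ← hρsq, div_self (by positivity)]
  have hexp (x : ℝ) : |x| ^ p ≤ 1 + k.factorial * (Real.exp x + Real.exp (-x)) := by
    have h1 : |x| ^ p ≤ 1 + |x| ^ k := by
      rcases le_total |x| 1 with h | h
      · linarith [Real.rpow_le_one (abs_nonneg x) h hp.le, pow_nonneg (abs_nonneg x) k]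
      · rw [← Real.rpow_natCast]
        linarith [Real.rpow_le_rpow_of_exponent_le h hk]
    have h2 := Real.pow_div_factorial_le_exp |x| (abs_nonneg x) k
    rw [div_le_iff₀ (by positivity)] at h2
    have h3 : Real.exp |x| ≤ Real.exp x + Real.exp (-x) := by
      rcases abs_cases x with h | h <;> rw [h.1] <;>
        linarith [Real.exp_pos x, Real.exp_pos (-x)]
    have h4 : (0 : ℝ) ≤ k.factorial := by positivity
    nlinarith
  have hscale (ε : Fin n → Bool) : |∑ i, boolSign (ε i) * a i| ^ p
      = ρ ^ p * |∑ i, boolSign (ε i) * (a i / ρ)| ^ p := by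
    rw [← Real.mul_rpow hpos.le (abs_nonneg _)]
    congr 1
    rw [← abs_of_pos hpos, ← abs_mul, abs_of_pos hpos, Finset.mul_sum]
    congr 1
    refine Finset.sum_congr rfl fun i _ => ?_
    field_simp
  simp_rw [hscale]
  rw [← Finset.mul_sum]
  have hE1 := sum_exp_sum_boolSign_le fun i => a i / ρ
  have hE2 := sum_exp_sum_boolSign_le fun i => -(a i / ρ)
  simp only [neg_sq, mul_neg, Finset.sum_neg_distrib, hone] at hE1 hE2
  have hsum : ∑ ε : Fin n → Bool, |∑ i, boolSign (ε i) * (a i / ρ)| ^ p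
      ≤ 2 ^ n * (1 + k.factorial * (2 * Real.exp (1 / 2))) := by
    refine (Finset.sum_le_sum fun ε _ => hexp _).trans ?_
    rw [Finset.sum_add_distrib, ← Finset.mul_sum, Finset.sum_add_distrib]
    simp only [Finset.sum_const, Finset.card_univ, Fintype.card_pi, Fintype.card_bool,
      Finset.prod_const, Fintype.card_fin, nsmul_eq_mul, mul_one]
    push_cast
    have h4 : (0 : ℝ) ≤ k.factorial := by positivity
    nlinarith
  calc _ ≤ ρ ^ p * (2 ^ n * (1 + k.factorial * (2 * Real.exp (1 / 2)))) := by gcongr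
    _ = _ := by ring

/-- **Khintchine's inequality**, upper estimate. -/
theorem exists_sum_norm_rpow_boolSign_le (𝕜 : Type*) [RCLike 𝕜] {p : ℝ} (hp : 0 < p) :
    ∃ C : ℝ, 0 < C ∧ ∀ (n : ℕ) (a : Fin n → 𝕜),
      ∑ ε : Fin n → Bool, ‖∑ i, (boolSign (ε i) : 𝕜) * a i‖ ^ p
        ≤ 2 ^ n * (C * √(∑ i, ‖a i‖ ^ 2) ^ p) := by
  obtain ⟨C, hC, h⟩ := exists_sum_abs_rpow_boolSign_le hp
  refine ⟨2 ^ p * (C + C), by positivity, fun n a => ?_⟩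
  have hpt (x : 𝕜) : ‖x‖ ^ p ≤ 2 ^ p * (|RCLike.re x| ^ p + |RCLike.im x| ^ p) := by
    have h1 : ‖x‖ ≤ 2 * max |RCLike.re x| |RCLike.im x| := by
      have h2 := RCLike.norm_sq_eq_def (z := x)
      refine abs_le_of_sq_le_sq' ?_ (by positivity) |>.2
      have h3 := pow_le_pow_left₀ (abs_nonneg _) (le_max_left |RCLike.re x| |RCLike.im x|) 2
      have h4 := pow_le_pow_left₀ (abs_nonneg _) (le_max_right |RCLike.re x| |RCLike.im x|) 2
      rw [sq_abs] at h3 h4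
      nlinarith
    calc ‖x‖ ^ p ≤ (2 * max |RCLike.re x| |RCLike.im x|) ^ p := by gcongr
      _ = 2 ^ p * (max |RCLike.re x| |RCLike.im x|) ^ p :=
          Real.mul_rpow (by norm_num) (by positivity)
      _ ≤ _ := by
          gcongr
          rcases max_cases |RCLike.re x| |RCLike.im x| with h | h <;> rw [h.1]
          · exact le_add_of_nonneg_right (by positivity)
          · exact le_add_of_nonneg_left (by positivity)
  have hre := h n fun i => RCLike.re (a i)
  have him := h n fun i => RCLike.im (a i)
  have hle1 : √(∑ i, RCLike.re (a i) ^ 2) ^ p ≤ √(∑ i, ‖a i‖ ^ 2) ^ p := by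
    refine Real.rpow_le_rpow (by positivity) (Real.sqrt_le_sqrt (Finset.sum_le_sum fun i _ => ?_))
      hp.le
    exact sq_le_sq.2 ((RCLike.abs_re_le_norm (a i)).trans (le_abs_self _))
  have hle2 : √(∑ i, RCLike.im (a i) ^ 2) ^ p ≤ √(∑ i, ‖a i‖ ^ 2) ^ p := by
    refine Real.rpow_le_rpow (by positivity) (Real.sqrt_le_sqrt (Finset.sum_le_sum fun i _ => ?_))
      hp.le
    exact sq_le_sq.2 ((RCLike.abs_im_le_norm (a i)).trans (le_abs_self _))
  refine (Finset.sum_le_sum fun ε _ => hpt _).trans ?_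
  simp only [map_sum, RCLike.re_ofReal_mul, RCLike.im_ofReal_mul]
  rw [← Finset.mul_sum, Finset.sum_add_distrib]
  calc _ ≤ 2 ^ p * (2 ^ n * (C * √(∑ i, ‖a i‖ ^ 2) ^ p)
        + 2 ^ n * (C * √(∑ i, ‖a i‖ ^ 2) ^ p)) := by
        gcongr
        · exact hre.trans (by gcongr)
        · exact him.trans (by gcongr)
    _ = _ := by ring

/-- **Khintchine's inequality**, lower estimate in `L_1`. -/
theorem exists_sqrt_le_sum_norm_boolSign (𝕜 : Type*) [RCLike 𝕜] :
    ∃ C : ℝ, 0 < C ∧ ∀ (n : ℕ) (a : Fin n → 𝕜),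
      2 ^ n * √(∑ i, ‖a i‖ ^ 2)
        ≤ C * ∑ ε : Fin n → Bool, ‖∑ i, (boolSign (ε i) : 𝕜) * a i‖ := by
  obtain ⟨K, hK, h⟩ := exists_sum_norm_rpow_boolSign_le 𝕜 (p := 4) (by norm_num)
  refine ⟨√K, by positivity, fun n a => ?_⟩
  set ρ := √(∑ i, ‖a i‖ ^ 2) with hρ
  have hρsq : ρ ^ 2 = ∑ i, ‖a i‖ ^ 2 := Real.sq_sqrt (by positivity)
  have hρ0 : 0 ≤ ρ := Real.sqrt_nonneg _
  rcases hρ0.eq_or_lt with h0 | hpos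
  · rw [← h0]
    simp only [mul_zero]
    positivity
  have h2 := sum_norm_sum_boolSign_sq a
  have h4 := h n a
  rw [← hρ] at h4
  simp only [Real.rpow_ofNat] at h4
  rw [← hρsq] at h2
  set u := √K * ρ with hu
  have hu0 : 0 < u := by positivity
  have husq : u ^ 2 = K * ρ ^ 2 := by rw [hu, mul_pow, Real.sq_sqrt hK.le]
  -- This bounds the second moment by the first and fourth, in place of interpolation. With `u = √K
  -- * ρ` the fourth-moment bound equals `u ^ 2` times the second moment and is absorbed on the
  -- left.
  have hpt (y : ℝ) (hy : 0 ≤ y) : 3 * u ^ 2 * y ^ 2 ≤ 2 * u ^ 3 * y + y ^ 4 := by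
    have : 0 ≤ y * (y - u) ^ 2 * (y + 2 * u) := by positivity
    nlinarith
  have hs := Finset.sum_le_sum fun (ε : Fin n → Bool) (_ : ε ∈ Finset.univ) =>
    hpt ‖∑ i, (boolSign (ε i) : 𝕜) * a i‖ (norm_nonneg _)
  rw [Finset.sum_add_distrib, ← Finset.mul_sum, ← Finset.mul_sum, h2] at hs
  set Y := ∑ ε : Fin n → Bool, ‖∑ i, (boolSign (ε i) : 𝕜) * a i‖
  have h5 : (2 * u ^ 2 * ρ) * (2 ^ n * ρ) ≤ (2 * u ^ 2 * ρ) * (√K * Y) := by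
    have e1 : (2 : ℝ) ^ n * (K * ρ ^ 4) = 2 ^ n * u ^ 2 * ρ ^ 2 := by rw [husq]; ring
    have e2 : 2 * u ^ 3 * Y = 2 * u ^ 2 * ρ * (√K * Y) := by rw [hu]; ring
    nlinarith
  exact le_of_mul_le_mul_left h5 (by positivity)

end Khintchine

/-! ### Power sums and subadditive estimates for concave powers. -/

section powerSums

theorem sum_range_rpow_neg_le {α : ℝ} (h0 : 0 ≤ α) (h1 : α < 1) (m : ℕ) :
    ∑ k ∈ Finset.range m, ((k : ℝ) + 1) ^ (-α) ≤ (m : ℝ) ^ (1 - α) / (1 - α) := by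
  have hα : 0 < 1 - α := by linarith
  induction m with
  | zero => simp [Real.zero_rpow hα.ne']
  | succ m ih =>
    rw [Finset.sum_range_succ]
    push_cast
    set y : ℝ := (m : ℝ) + 1 with hy
    have hy1 : 1 ≤ y := by simp [hy]
    have hy0 : 0 < y := by linarith
    have hB := rpow_one_add_le_one_add_mul_self (s := -(1 / y))
      (by rw [neg_le_neg_iff, div_le_one hy0]; exact hy1) hα.le (by linarith : 1 - α ≤ 1)
    have hm : (m : ℝ) ^ (1 - α) = y ^ (1 - α) * (1 + -(1 / y)) ^ (1 - α) := by
      rw [← Real.mul_rpow hy0.le]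
      · congr 1
        field_simp
        linarith
      · rw [← sub_eq_add_neg, sub_nonneg, div_le_one hy0]
        exact hy1
    have hyα : y ^ (-α) = y ^ (1 - α) * (1 / y) := by
      rw [show -α = (1 - α) - 1 by ring, Real.rpow_sub_one hy0.ne']
      ring
    have hpos : 0 < y ^ (1 - α) := by positivity
    rw [le_div_iff₀ hα] at ih ⊢
    have : y ^ (1 - α) * (1 + -(1 / y)) ^ (1 - α)
        ≤ y ^ (1 - α) * (1 + (1 - α) * -(1 / y)) := by gcongr
    rw [add_mul, hyα]
    nlinarith

theorem sum_range_add_rpow_neg_le {β : ℝ} (hβ : 1 < β) {x : ℝ} (hx : 0 < x) (N : ℕ) :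
    ∑ k ∈ Finset.range N, (x + k + 1) ^ (-β)
      ≤ (x ^ (1 - β) - (x + N) ^ (1 - β)) / (β - 1) := by
  have hc : 0 < β - 1 := by linarith
  induction N with
  | zero => simp
  | succ N ih =>
    rw [Finset.sum_range_succ]
    push_cast
    rw [← add_assoc]
    set w : ℝ := x + N with hw
    have hw0 : 0 < w := by positivity
    have hy0 : 0 < w + 1 := by positivity
    have hB : 1 + (β - 1) / (w + 1) ≤ (w / (w + 1)) ^ (1 - β) := by
      rw [Real.rpow_def_of_pos (by positivity)]
      have hlog := Real.log_le_sub_one_of_pos (show 0 < w / (w + 1) by positivity)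
      have e : w / (w + 1) - 1 = -(1 / (w + 1)) := by
        field_simp
        ring
      rw [e] at hlog
      have h2 := Real.add_one_le_exp (Real.log (w / (w + 1)) * (1 - β))
      refine le_trans ?_ h2
      have : (β - 1) / (w + 1) = -(1 / (w + 1)) * (1 - β) := by ring
      nlinarith
    rw [Real.div_rpow hw0.le hy0.le, le_div_iff₀ (by positivity)] at hB
    have hyβ : (w + 1) ^ (-β) = (w + 1) ^ (1 - β) / (w + 1) := by
      rw [show -β = (1 - β) - 1 by ring, Real.rpow_sub_one hy0.ne']
    rw [le_div_iff₀ hc] at ih ⊢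
    rw [add_mul, hyβ]
    have : (1 + (β - 1) / (w + 1)) * (w + 1) ^ (1 - β)
        = (w + 1) ^ (1 - β) + (w + 1) ^ (1 - β) / (w + 1) * (β - 1) := by ring
    linarith

/-- Split at `k = ⌊v⌋₊`: the exponent `α < 1` is summable from the left, `β > 1` on the tail, and
the middle term is at most `v`. Linearity in `v` is what later allows summation over coordinates. -/
theorem sum_range_min_rpow_le {α β : ℝ} (h0 : 0 ≤ α) (h1 : α < 1) (hβ : 1 < β) {v : ℝ}
    (hv : 0 ≤ v) (L : ℕ) :
    ∑ k ∈ Finset.range L, min ((v / ((k : ℝ) + 1)) ^ β) ((v / ((k : ℝ) + 1)) ^ α)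
      ≤ (1 / (1 - α) + 1 + 1 / (β - 1)) * v := by
  set m := ⌊v⌋₊ with hm
  have hmv : (m : ℝ) ≤ v := Nat.floor_le hv
  have hvm : v < (m : ℝ) + 1 := Nat.lt_floor_add_one v
  have hα : 0 < 1 - α := by linarith
  have hc : 0 < β - 1 := by linarith
  set f : ℕ → ℝ := fun k => min ((v / ((k : ℝ) + 1)) ^ β) ((v / ((k : ℝ) + 1)) ^ α) with hf
  have hf0 (k : ℕ) : 0 ≤ f k := by positivity
  have hsub : ∑ k ∈ Finset.range L, f k ≤ ∑ k ∈ Finset.range (m + 1 + L), f k :=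
    Finset.sum_le_sum_of_subset_of_nonneg
      (Finset.range_subset_range.2 (by omega)) fun _ _ _ => hf0 _
  refine hsub.trans ?_
  rw [Finset.sum_range_add, Finset.sum_range_succ]
  have hA : ∑ k ∈ Finset.range m, f k ≤ 1 / (1 - α) * v := by
    calc _ ≤ ∑ k ∈ Finset.range m, v ^ α * ((k : ℝ) + 1) ^ (-α) := by
          refine Finset.sum_le_sum fun k _ => (min_le_right _ _).trans_eq ?_
          rw [Real.div_rpow hv (by positivity), Real.rpow_neg (by positivity), div_eq_mul_inv]
      _ ≤ v ^ α * ((m : ℝ) ^ (1 - α) / (1 - α)) := by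
          rw [← Finset.mul_sum]
          gcongr
          exact sum_range_rpow_neg_le h0 h1 m
      _ ≤ v ^ α * (v ^ (1 - α) / (1 - α)) := by gcongr
      _ = v ^ (α + (1 - α)) / (1 - α) := by
          rw [Real.rpow_add_of_nonneg hv h0 hα.le]
          ring
      _ = _ := by
          rw [add_sub_cancel, Real.rpow_one]
          ring
  have hq1 : v / ((m : ℝ) + 1) ≤ 1 := (div_le_one (by positivity)).2 hvm.le
  have hB : f m ≤ v := by
    calc f m ≤ (v / ((m : ℝ) + 1)) ^ β := min_le_left _ _
      _ ≤ v / ((m : ℝ) + 1) := by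
          simpa using Real.rpow_le_rpow_of_exponent_ge_of_imp (by positivity) hq1 hβ.le
            (fun _ h => by linarith)
      _ ≤ v := div_le_self hv (by linarith [(Nat.cast_nonneg m : (0 : ℝ) ≤ m)])
  have hC : ∑ k ∈ Finset.range L, f (m + 1 + k) ≤ 1 / (β - 1) * v := by
    calc _ ≤ ∑ k ∈ Finset.range L, v ^ β * (((m : ℝ) + 1) + k + 1) ^ (-β) := by
          refine Finset.sum_le_sum fun k _ => (min_le_left _ _).trans_eq ?_
          push_cast
          rw [Real.div_rpow hv (by positivity), Real.rpow_neg (by positivity), div_eq_mul_inv]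
      _ ≤ v ^ β * (((m : ℝ) + 1) ^ (1 - β) / (β - 1)) := by
          rw [← Finset.mul_sum]
          refine mul_le_mul_of_nonneg_left ?_ (by positivity)
          refine (sum_range_add_rpow_neg_le hβ (by positivity) L).trans ?_
          gcongr
          have : 0 ≤ ((m : ℝ) + 1 + L) ^ (1 - β) := by positivity
          linarith
      _ = v * (v / ((m : ℝ) + 1)) ^ (β - 1) / (β - 1) := by
          rw [Real.div_rpow hv (by positivity),
            show v ^ β = v ^ (1 + (β - 1)) by ring_nf,
            Real.rpow_add_of_nonneg hv zero_le_one hc.le, Real.rpow_one,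
            show (1 - β) = -(β - 1) by ring, Real.rpow_neg (by positivity)]
          ring
      _ ≤ v * 1 / (β - 1) := by
          gcongr
          exact Real.rpow_le_one (by positivity) hq1 hc.le
      _ = _ := by ring
  linarith

theorem add_rpow_le_add_min {κ M t : ℝ} (hκ0 : 0 ≤ κ) (hκ1 : κ ≤ 1) (hM : 1 ≤ M) (ht : 0 ≤ t) :
    (M + t) ^ κ ≤ M ^ κ + min t (t ^ κ) := by
  have hM0 : 0 < M := by linarith
  rw [← min_add_add_left, le_min_iff]
  refine ⟨?_, Real.rpow_add_le_add_rpow hM0.le ht hκ0 hκ1⟩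
  have hB := rpow_one_add_le_one_add_mul_self (s := t / M) (by
    have : 0 ≤ t / M := by positivity
    linarith) hκ0 hκ1
  have h1 : (M + t) ^ κ = M ^ κ * (1 + t / M) ^ κ := by
    rw [← Real.mul_rpow hM0.le (by positivity)]
    congr 1
    field_simp
  have h2 : M ^ κ ≤ M := by
    simpa using Real.rpow_le_rpow_of_exponent_le hM hκ1
  rw [h1]
  calc M ^ κ * (1 + t / M) ^ κ ≤ M ^ κ * (1 + κ * (t / M)) := by gcongr
    _ = M ^ κ + κ * t * (M ^ κ / M) := by ring
    _ ≤ M ^ κ + 1 * t * 1 := by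
        gcongr
        exact (div_le_one hM0).2 h2
    _ = _ := by ring

/-- Starting the sum at `1` keeps the base at least `1`, where adding `t` raises the power by at
most `min t (t ^ κ)`. The bound separates the variables, so its mean depends only on the marginals.
-/
theorem sum_rpow_le_one_add_sum_min {ι : Type*} (s : Finset ι) {κ : ℝ} (hκ0 : 0 ≤ κ)
    (hκ1 : κ ≤ 1) {t : ι → ℝ} (ht : ∀ i, 0 ≤ t i) :
    (∑ i ∈ s, t i) ^ κ ≤ 1 + ∑ i ∈ s, min (t i) (t i ^ κ) := by
  classical
  have key : (1 + ∑ i ∈ s, t i) ^ κ ≤ 1 + ∑ i ∈ s, min (t i) (t i ^ κ) := by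
    induction s using Finset.induction_on with
    | empty => simp
    | insert a s ha ih =>
      rw [Finset.sum_insert ha, Finset.sum_insert ha, add_comm (t a), ← add_assoc]
      have hs : 0 ≤ ∑ i ∈ s, t i := Finset.sum_nonneg fun i _ => ht i
      linarith [add_rpow_le_add_min hκ0 hκ1 (by linarith : 1 ≤ 1 + ∑ i ∈ s, t i) (ht a)]
  refine le_trans ?_ key
  have hs : 0 ≤ ∑ i ∈ s, t i := Finset.sum_nonneg fun i _ => ht i
  gcongr
  linarith

end powerSums

/-! ### Random signs and power-law coordinates as substitutes for Gaussian and stable variables. -/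

section sampling

theorem mul_sum_pi_sum_apply {L n : ℕ} (g : Fin n → Fin L → ℝ) :
    (L : ℝ) * ∑ l : Fin n → Fin L, ∑ i, g i (l i) = (L : ℝ) ^ n * ∑ i, ∑ a, g i a := by
  induction n with
  | zero => simp
  | succ n ih =>
    rw [Fin.sum_pi_succ]
    simp only [Fin.sum_univ_succ, Fin.cons_zero, Fin.cons_succ, Finset.sum_add_distrib,
      Finset.sum_const, Finset.card_univ, Fintype.card_fin, nsmul_eq_mul, Fintype.card_pi,
      Finset.prod_const, ← Finset.mul_sum]
    rw [ih fun i => g i.succ]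
    push_cast
    ring

theorem card_filter_succ_le {L : ℕ} {v : ℝ} (hvL : v ≤ L) :
    v - 1 ≤ ∑ a : Fin L, if ((a : ℕ) : ℝ) + 1 ≤ v then (1 : ℝ) else 0 := by
  rw [Fin.sum_univ_eq_sum_range (fun a => if (a : ℝ) + 1 ≤ v then (1 : ℝ) else 0) L]
  rcases le_or_gt v 0 with hv | hv
  · refine le_trans (by linarith) (Finset.sum_nonneg fun a _ => ?_)
    split_ifs <;> norm_num
  have hm : ⌊v⌋₊ ≤ L := Nat.floor_le_of_le hvL
  calc v - 1 ≤ ⌊v⌋₊ := by linarith [Nat.lt_floor_add_one v]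
    _ = ∑ a ∈ Finset.range ⌊v⌋₊, (1 : ℝ) := by simp
    _ = ∑ a ∈ Finset.range ⌊v⌋₊, if (a : ℝ) + 1 ≤ v then (1 : ℝ) else 0 := by
        refine Finset.sum_congr rfl fun a ha => ?_
        rw [if_pos]
        have h1 : a + 1 ≤ ⌊v⌋₊ := Finset.mem_range.1 ha
        have h2 : ((a + 1 : ℕ) : ℝ) ≤ ⌊v⌋₊ := by exact_mod_cast h1
        push_cast at h2
        exact h2.trans (Nat.floor_le hv.le)
    _ ≤ _ := by
        refine Finset.sum_le_sum_of_subset_of_nonneg (Finset.range_subset_range.2 hm)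
          fun a _ _ => ?_
        split_ifs <;> norm_num

/-- With independent coordinates `(L / l) ^ (1 / a)`, `l` uniform in `1, …, L`, the square function
of a normalised vector of `ℓ_a` has large expectation. -/
theorem third_le_sum_sqrt_powerLaw {a : ℝ} (ha : 0 < a) {n L : ℕ} (hL : 0 < L) (hnL : 2 * n ≤ L)
    {c : Fin n → ℝ} (hc0 : ∀ i, 0 ≤ c i) (hc : ∑ i, c i ^ a = 1) :
    (L : ℝ) ^ n / 3 ≤ ∑ l : Fin n → Fin L,
      √(∑ i, (c i * ((L : ℝ) / (((l i : ℕ) : ℝ) + 1)) ^ (1 / a)) ^ 2) := by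
  have hLpos : (0 : ℝ) < L := by exact_mod_cast hL
  set g : Fin n → Fin L → ℝ := fun i k => if ((k : ℕ) : ℝ) + 1 ≤ L * c i ^ a then 1 else 0 with hg
  have hle1 (i : Fin n) : c i ^ a ≤ 1 := by
    rw [← hc]
    exact Finset.single_le_sum (f := fun i => c i ^ a)
      (fun i _ => Real.rpow_nonneg (hc0 i) a) (Finset.mem_univ i)
  -- The left side indicates that some coordinate contributes at least `1`. By independence the
  -- complementary event has probability at most `∏ exp (-(c i ^ a - 1 / L))`, where `1 / L` pays
  -- for rounding. This is at most `exp (-1 / 2) ≤ 2 / 3` since `n / L ≤ 1 / 2`.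
  have hpt (l : Fin n → Fin L) : 1 - ∏ i, (1 - g i (l i)) ≤
      √(∑ i, (c i * ((L : ℝ) / (((l i : ℕ) : ℝ) + 1)) ^ (1 / a)) ^ 2) := by
    by_cases h : ∃ i, (((l i : ℕ) : ℝ)) + 1 ≤ L * c i ^ a
    · obtain ⟨i, hi⟩ := h
      have hprod : ∏ i, (1 - g i (l i)) = 0 :=
        Finset.prod_eq_zero (Finset.mem_univ i) (by simp [hg, hi])
      rw [hprod, sub_zero]
      refine Real.le_sqrt_of_sq_le ?_
      have h1 : 1 ≤ c i * ((L : ℝ) / (((l i : ℕ) : ℝ) + 1)) ^ (1 / a) := by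
        have h2 : 1 ≤ c i ^ a * ((L : ℝ) / (((l i : ℕ) : ℝ) + 1)) := by
          rw [mul_div_assoc', le_div_iff₀ (by positivity)]
          linarith
        have h3 := Real.one_le_rpow h2 (by positivity : 0 ≤ 1 / a)
        rwa [Real.mul_rpow (Real.rpow_nonneg (hc0 i) a) (by positivity), ← Real.rpow_mul (hc0 i),
          mul_one_div_cancel ha.ne', Real.rpow_one] at h3
      calc (1 : ℝ) ^ 2 ≤ (c i * ((L : ℝ) / (((l i : ℕ) : ℝ) + 1)) ^ (1 / a)) ^ 2 := by gcongr
        _ ≤ _ := Finset.single_le_sum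
          (f := fun i => (c i * ((L : ℝ) / (((l i : ℕ) : ℝ) + 1)) ^ (1 / a)) ^ 2)
          (fun _ _ => sq_nonneg _) (Finset.mem_univ i)
    · push Not at h
      have hprod : ∏ i, (1 - g i (l i)) = 1 :=
        Finset.prod_eq_one fun i _ => by simp [hg, h i]
      rw [hprod, sub_self]
      exact Real.sqrt_nonneg _
  refine le_trans ?_ (Finset.sum_le_sum fun l _ => hpt l)
  have hfac := Finset.prod_univ_sum (fun _ : Fin n => (Finset.univ : Finset (Fin L)))
    fun i k => 1 - g i k
  simp only [Fintype.piFinset_univ] at hfac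
  rw [Finset.sum_sub_distrib, ← hfac]
  simp only [Finset.sum_const, Finset.card_univ, Fintype.card_pi, Fintype.card_fin,
    Finset.prod_const, nsmul_eq_mul, mul_one, Finset.sum_sub_distrib]
  push_cast
  have hfactor (i : Fin n) : 0 ≤ (L : ℝ) - ∑ k, g i k ∧
      (L : ℝ) - ∑ k, g i k ≤ L * Real.exp (-(c i ^ a - 1 / L)) := by
    constructor
    · have : ∑ k, g i k ≤ ∑ _k : Fin L, (1 : ℝ) := by
        refine Finset.sum_le_sum fun k _ => ?_
        simp only [hg]
        split_ifs <;> norm_num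
      simpa using this
    · have h1 := card_filter_succ_le (L := L) (v := L * c i ^ a) (by nlinarith [hle1 i])
      have h2 := Real.add_one_le_exp (-(c i ^ a - 1 / L))
      have h3 : (L : ℝ) * (-(c i ^ a - 1 / L) + 1) = L - (L * c i ^ a - 1) := by
        field_simp
        ring
      have h4 : L - (L * c i ^ a - 1) ≤ (L : ℝ) * Real.exp (-(c i ^ a - 1 / L)) := by
        rw [← h3]
        gcongr
      linarith
  have hprod : ∏ i, ((L : ℝ) - ∑ k, g i k) ≤ L ^ n * Real.exp (-(1 / 2)) := by
    calc _ ≤ ∏ i, (L : ℝ) * Real.exp (-(c i ^ a - 1 / L)) :=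
          Finset.prod_le_prod (fun i _ => (hfactor i).1) fun i _ => (hfactor i).2
      _ = L ^ n * Real.exp (-(1 - n / L)) := by
          rw [Finset.prod_mul_distrib, ← Real.exp_sum, Finset.sum_neg_distrib,
            Finset.sum_sub_distrib, hc]
          simp [div_eq_mul_inv]
      _ ≤ _ := by
          have : (n : ℝ) / L ≤ 1 / 2 := by
            rw [div_le_div_iff₀ hLpos two_pos]
            have : ((2 * n : ℕ) : ℝ) ≤ L := by exact_mod_cast hnL
            push_cast at this
            linarith
          gcongr
          linarith
  have hexp : Real.exp (-(1 / 2)) ≤ 2 / 3 := by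
    rw [Real.exp_neg]
    have := Real.add_one_le_exp (1 / 2 : ℝ)
    exact (inv_anti₀ (by norm_num : (0 : ℝ) < 3 / 2) (by linarith)).trans (by norm_num)
  have hLn : (0 : ℝ) < L ^ n := by positivity
  nlinarith

/-- The `p / 2` power of the sum of squares is separated into one-coordinate terms. Since `p / a < 1
< 2 / a`, coordinate `i` has mean at most `D * c i ^ a`, and these add up to `D`. -/
theorem sum_sqrt_rpow_powerLaw_le {p a : ℝ} (hp : 0 < p) (hpa : p < a) (ha : a < 2) {n L : ℕ}
    (hL : 0 < L) {c : Fin n → ℝ} (hc0 : ∀ i, 0 ≤ c i) (hc : ∑ i, c i ^ a = 1) :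
    ∑ l : Fin n → Fin L, √(∑ i, (c i * ((L : ℝ) / (((l i : ℕ) : ℝ) + 1)) ^ (1 / a)) ^ 2) ^ p
      ≤ (L : ℝ) ^ n * (1 + (1 / (1 - p / a) + 1 + 1 / (2 / a - 1))) := by
  have hLpos : (0 : ℝ) < L := by exact_mod_cast hL
  have ha0 : 0 < a := by linarith
  set D : ℝ := 1 / (1 - p / a) + 1 + 1 / (2 / a - 1) with hD
  set g : Fin n → Fin L → ℝ := fun i k =>
    min ((L * c i ^ a / (((k : ℕ) : ℝ) + 1)) ^ (2 / a))
      ((L * c i ^ a / (((k : ℕ) : ℝ) + 1)) ^ (p / a)) with hg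
  have hpt (l : Fin n → Fin L) :
      √(∑ i, (c i * ((L : ℝ) / (((l i : ℕ) : ℝ) + 1)) ^ (1 / a)) ^ 2) ^ p
        ≤ 1 + ∑ i, g i (l i) := by
    have h1 := sum_rpow_le_one_add_sum_min Finset.univ (κ := p / 2) (by positivity) (by linarith)
      (t := fun i => (c i * ((L : ℝ) / (((l i : ℕ) : ℝ) + 1)) ^ (1 / a)) ^ 2)
      fun _ => sq_nonneg _
    have h2 (i : Fin n) : (c i * ((L : ℝ) / (((l i : ℕ) : ℝ) + 1)) ^ (1 / a)) ^ 2
        = (L * c i ^ a / (((l i : ℕ) : ℝ) + 1)) ^ (2 / a) := by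
      have h0 : 0 ≤ c i ^ a := Real.rpow_nonneg (hc0 i) a
      rw [← Real.rpow_natCast, Real.mul_rpow (hc0 i) (by positivity), mul_comm (L : ℝ),
        mul_div_assoc, Real.mul_rpow h0 (by positivity), ← Real.rpow_mul (hc0 i),
        ← Real.rpow_mul (by positivity)]
      congr 2 <;> push_cast <;> field_simp
    rw [Real.sqrt_eq_rpow, ← Real.rpow_mul (Finset.sum_nonneg fun _ _ => sq_nonneg _),
      show 1 / 2 * p = p / 2 by ring]
    refine h1.trans_eq ?_
    congr 1
    refine Finset.sum_congr rfl fun i _ => ?_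
    have h0 : 0 ≤ c i ^ a := Real.rpow_nonneg (hc0 i) a
    rw [h2, ← Real.rpow_mul (by positivity)]
    congr 2
    field_simp
  refine (Finset.sum_le_sum fun l _ => hpt l).trans ?_
  rw [Finset.sum_add_distrib]
  have hmarg := mul_sum_pi_sum_apply g
  have hg1 : ∑ i, ∑ k, g i k ≤ D * L := by
    calc _ ≤ ∑ i, D * (L * c i ^ a) := by
          refine Finset.sum_le_sum fun i _ => ?_
          rw [Fin.sum_univ_eq_sum_range (fun k => min ((L * c i ^ a / ((k : ℝ) + 1)) ^ (2 / a))
            ((L * c i ^ a / ((k : ℝ) + 1)) ^ (p / a))) L]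
          have h0 : 0 ≤ c i ^ a := Real.rpow_nonneg (hc0 i) a
          exact sum_range_min_rpow_le (by positivity) ((div_lt_one ha0).2 hpa)
            ((one_lt_div ha0).2 ha) (by positivity) L
      _ = _ := by rw [← Finset.mul_sum, ← Finset.mul_sum, hc, mul_one]
  have hfin : ∑ l : Fin n → Fin L, ∑ i, g i (l i) ≤ L ^ n * D := by
    refine le_of_mul_le_mul_left ?_ hLpos
    rw [hmarg]
    calc _ ≤ (L : ℝ) ^ n * (D * L) := by gcongr
      _ = _ := by ring
  simp only [Finset.sum_const, Finset.card_univ, Fintype.card_pi, Fintype.card_fin,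
    Finset.prod_const, nsmul_eq_mul, mul_one]
  push_cast
  linarith

/-- Samplings of `ℓ_a^n` for `a < 2` by signed vectors with power-law coordinates. -/
theorem exists_sampling_of_lt_two (𝕜 : Type*) [RCLike 𝕜] {p a : ℝ} (hp : 1 ≤ p) (hpa : p < a)
    (ha : a < 2) : ∃ A B : ℝ, 0 ≤ A ∧ 0 ≤ B ∧ ∀ n : ℕ, ∃ (Ω : Type) (_ : Fintype Ω)
      (_ : Nonempty Ω) (θ : Ω → Fin n → 𝕜), ∀ c : Fin n → 𝕜, ∑ i, ‖c i‖ ^ a = 1 →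
        (Fintype.card Ω : ℝ) ≤ A * ∑ ω, ‖∑ i, θ ω i * c i‖ ∧
        ∑ ω, ‖∑ i, θ ω i * c i‖ ^ p ≤ Fintype.card Ω * B := by
  have hp0 : 0 < p := by linarith
  obtain ⟨C₁, hC₁, hlow⟩ := exists_sqrt_le_sum_norm_boolSign 𝕜
  obtain ⟨C₂, hC₂, hup⟩ := exists_sum_norm_rpow_boolSign_le 𝕜 hp0
  have hD : 0 ≤ 1 + (1 / (1 - p / a) + 1 + 1 / (2 / a - 1)) := by
    have h1 : 0 < 1 - p / a := sub_pos.2 ((div_lt_one (by linarith)).2 hpa)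
    have h2 : 0 < 2 / a - 1 := sub_pos.2 ((one_lt_div (by linarith)).2 ha)
    positivity
  refine ⟨3 * C₁, C₂ * (1 + (1 / (1 - p / a) + 1 + 1 / (2 / a - 1))), by positivity,
    by positivity, fun n => ?_⟩
  -- The lower estimate needs `2 * n ≤ L`; the extra `1` keeps `L` positive when `n = 0`.
  set L := 2 * n + 1 with hL
  let ρ : Fin L → ℝ := fun k => ((L : ℝ) / (((k : ℕ) : ℝ) + 1)) ^ (1 / a)
  have hρ (k : Fin L) : 0 ≤ ρ k := by positivity
  refine ⟨(Fin n → Fin L) × (Fin n → Bool), inferInstance, inferInstance,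
    fun ω i => (boolSign (ω.2 i) : 𝕜) * (ρ (ω.1 i) : 𝕜), fun c hc => ?_⟩
  have hnorm (l : Fin n → Fin L) (i : Fin n) : ‖(ρ (l i) : 𝕜) * c i‖ = ‖c i‖ * ρ (l i) := by
    rw [norm_mul, RCLike.norm_ofReal, abs_of_nonneg (hρ _), mul_comm]
  have hcard : (Fintype.card ((Fin n → Fin L) × (Fin n → Bool)) : ℝ) = L ^ n * 2 ^ n := by
    simp
  rw [hcard, Fintype.sum_prod_type, Fintype.sum_prod_type]
  simp only [mul_assoc]
  constructor
  · have h1 := third_le_sum_sqrt_powerLaw (a := a) (by linarith) (L := L) (by omega) (by omega)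
      (fun i => norm_nonneg (c i)) hc
    have h2 := Finset.sum_le_sum fun (l : Fin n → Fin L) (_ : l ∈ Finset.univ) =>
      hlow n fun i => (ρ (l i) : 𝕜) * c i
    rw [← Finset.mul_sum, ← Finset.mul_sum] at h2
    simp only [hnorm] at h2
    have h3 : (2 : ℝ) ^ n * ((L : ℝ) ^ n / 3) ≤ _ := (mul_le_mul_of_nonneg_left h1
      (by positivity)).trans h2
    linarith
  · have h1 := sum_sqrt_rpow_powerLaw_le hp0 hpa ha (L := L) (by omega)
      (fun i => norm_nonneg (c i)) hc
    refine (Finset.sum_le_sum fun l _ => hup n fun i => (ρ (l i) : 𝕜) * c i).trans ?_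
    rw [← Finset.mul_sum, ← Finset.mul_sum]
    simp only [hnorm]
    calc _ ≤ (2 : ℝ) ^ n * (C₂ * ((L : ℝ) ^ n *
          (1 + (1 / (1 - p / a) + 1 + 1 / (2 / a - 1))))) := by gcongr
      _ = _ := by ring

/-- Samplings of `ℓ_2^n` by vectors of signs. -/
theorem exists_sampling_two (𝕜 : Type*) [RCLike 𝕜] {p : ℝ} (hp : 1 ≤ p) :
    ∃ A B : ℝ, 0 ≤ A ∧ 0 ≤ B ∧ ∀ n : ℕ, ∃ (Ω : Type) (_ : Fintype Ω)
      (_ : Nonempty Ω) (θ : Ω → Fin n → 𝕜), ∀ c : Fin n → 𝕜, ∑ i, ‖c i‖ ^ (2 : ℝ) = 1 →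
        (Fintype.card Ω : ℝ) ≤ A * ∑ ω, ‖∑ i, θ ω i * c i‖ ∧
        ∑ ω, ‖∑ i, θ ω i * c i‖ ^ p ≤ Fintype.card Ω * B := by
  obtain ⟨C₁, hC₁, hlow⟩ := exists_sqrt_le_sum_norm_boolSign 𝕜
  obtain ⟨C₂, hC₂, hup⟩ := exists_sum_norm_rpow_boolSign_le 𝕜 (by linarith : 0 < p)
  refine ⟨C₁, C₂, hC₁.le, hC₂.le, fun n => ⟨Fin n → Bool, inferInstance, inferInstance,
    fun ε i => (boolSign (ε i) : 𝕜), fun c hc => ?_⟩⟩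
  simp only [Real.rpow_ofNat] at hc
  have h1 := hlow n c
  have h2 := hup n c
  rw [hc, Real.sqrt_one] at h1 h2
  rw [Real.one_rpow] at h2
  simp only [Fintype.card_pi, Fintype.card_bool, Finset.prod_const, Finset.card_univ,
    Fintype.card_fin]
  push_cast
  exact ⟨by linarith, by linarith⟩

end sampling

/-! ### The dual norm of `ℓ_r^n` in terms of coefficients. -/

section dual

theorem StrongDual.piLp_apply {𝕜 : Type*} [RCLike 𝕜] {r : ℝ≥0∞} {n : ℕ}
    (γ : StrongDual 𝕜 (PiLp r (fun _ : Fin n => 𝕜)))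
    (x : PiLp r (fun _ : Fin n => 𝕜)) :
    γ x = ∑ i, x i * γ (WithLp.toLp r (Pi.single i 1)) := by
  have hx : x = ∑ i, x i • WithLp.toLp r (Pi.single i (1 : 𝕜)) := by
    ext j
    simp [Pi.single_apply]
  conv_lhs => rw [hx]
  simp

variable {𝕜 : Type*} [RCLike 𝕜] {r : ℝ≥0∞} [Fact (1 ≤ r)] {n : ℕ}

/-- The dual norm of a functional on `ℓ_r^n` with coefficients normalised in the conjugate
space is one. -/
theorem StrongDual.piLp_norm_eq_one {a : ℝ} (hra : r.toReal.HolderConjugate a)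
    (γ : StrongDual 𝕜 (PiLp r (fun _ : Fin n => 𝕜)))
    (hγ : ∑ i, ‖γ (WithLp.toLp r (Pi.single i 1))‖ ^ a = 1) : ‖γ‖ = 1 := by
  have hr0 := hra.pos
  have ha0 := hra.symm.pos
  set c : Fin n → 𝕜 := fun i => γ (WithLp.toLp r (Pi.single i 1)) with hc
  apply le_antisymm
  · refine γ.opNorm_le_bound zero_le_one fun x => ?_
    rw [StrongDual.piLp_apply, one_mul]
    calc ‖∑ i, x i * c i‖ ≤ ∑ i, ‖x i‖ * ‖c i‖ :=
          (norm_sum_le _ _).trans_eq (by simp only [norm_mul])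
      _ ≤ (∑ i, ‖x i‖ ^ r.toReal) ^ (1 / r.toReal) * (∑ i, ‖c i‖ ^ a) ^ (1 / a) :=
          Real.inner_le_Lp_mul_Lq_of_nonneg _ hra (fun _ _ => norm_nonneg _)
            fun _ _ => norm_nonneg _
      _ = ‖x‖ := by rw [hγ, Real.one_rpow, mul_one, PiLp.norm_eq_sum hr0]
  -- The extremal vector for Hölder. Where `c i = 0` the conjugate factor makes the entry zero,
  -- whatever the value of `0 ^ (a - 2)`.
  · let x : PiLp r (fun _ : Fin n => 𝕜) :=
      WithLp.toLp r fun i => (starRingEnd 𝕜) (c i) * ((‖c i‖ ^ (a - 2) : ℝ) : 𝕜)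
    have hxn (i : Fin n) : ‖x i‖ ^ r.toReal = ‖c i‖ ^ a := by
      have h1 : ‖x i‖ = ‖c i‖ * ‖c i‖ ^ (a - 2) := by
        simp [x, abs_of_nonneg (Real.rpow_nonneg (norm_nonneg (c i)) _)]
      rcases eq_or_ne (c i) 0 with h0 | h0
      · rw [h1, h0]
        simp [Real.zero_rpow ha0.ne', Real.zero_rpow hr0.ne']
      · have hpos : 0 < ‖c i‖ := norm_pos_iff.2 h0
        rw [h1, ← Real.rpow_one_add' hpos.le (by
            have := hra.symm.lt
            linarith), ← Real.rpow_mul hpos.le]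
        congr 1
        have := hra.mul_eq_add
        linarith
    have hx : ‖x‖ = 1 := by
      rw [PiLp.norm_eq_sum hr0]
      simp only [hxn]
      rw [hγ, Real.one_rpow]
    have hγx : γ x = 1 := by
      rw [StrongDual.piLp_apply]
      have (i : Fin n) : x i * c i = ((‖c i‖ ^ a : ℝ) : 𝕜) := by
        rcases eq_or_ne (c i) 0 with h0 | h0
        · simp [h0, Real.zero_rpow ha0.ne']
        · have hpos : 0 < ‖c i‖ := norm_pos_iff.2 h0
          have e : x i * c i = (starRingEnd 𝕜) (c i) * c i * ((‖c i‖ ^ (a - 2) : ℝ) : 𝕜) := by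
            simp only [x]
            ring
          rw [e, RCLike.conj_mul, ← RCLike.ofReal_pow, ← RCLike.ofReal_mul]
          congr 1
          rw [← Real.rpow_natCast, ← Real.rpow_add hpos]
          congr 1
          push_cast
          ring
      change ∑ i, x i * c i = 1
      rw [Finset.sum_congr rfl fun i _ => this i, ← RCLike.ofReal_sum, hγ, RCLike.ofReal_one]
    have := γ.le_opNorm x
    rwa [hγx, hx, norm_one, mul_one] at this

/-- Both sampling estimates are homogeneous in the functional, so normalised coefficients suffice
once the zero functional is set aside. -/
theorem exists_isDualSampling_of_coeff {p a A B : ℝ} (hp : 1 ≤ p)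
    (hra : r.toReal.HolderConjugate a)
    {Ω : Type} [Fintype Ω] [Nonempty Ω] (θ : Ω → Fin n → 𝕜)
    (hθ : ∀ c : Fin n → 𝕜, ∑ i, ‖c i‖ ^ a = 1 →
        (Fintype.card Ω : ℝ) ≤ A * ∑ ω, ‖∑ i, θ ω i * c i‖ ∧
        ∑ ω, ‖∑ i, θ ω i * c i‖ ^ p ≤ Fintype.card Ω * B) :
    ∃ (L : ℕ) (η : Fin L → PiLp r (fun _ : Fin n => 𝕜)),
      IsDualSampling 𝕜 p A (B ^ (1 / p)) η := by
  have hp0 : 0 < p := by linarith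
  have ha0 := hra.symm.pos
  let e := (Fintype.equivFin Ω).symm
  have hcard : (0 : ℝ) < Fintype.card Ω := by exact_mod_cast Fintype.card_pos
  set η : Fin (Fintype.card Ω) → PiLp r (fun _ : Fin n => 𝕜) := fun k => WithLp.toLp r (θ (e k))
    with hη
  have hunit (γ : StrongDual 𝕜 (PiLp r (fun _ : Fin n => 𝕜)))
      (hγ : ∑ i, ‖γ (WithLp.toLp r (Pi.single i 1))‖ ^ a = 1) :
      ‖γ‖ ≤ A * ∑ ω, ‖γ (η ω)‖ * (Fintype.card Ω : ℝ)⁻¹ ∧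
      (∑ ω, ‖γ (η ω)‖ ^ p * (Fintype.card Ω : ℝ)⁻¹) ^ (1 / p) ≤ B ^ (1 / p) * ‖γ‖ := by
    rw [StrongDual.piLp_norm_eq_one hra γ hγ, mul_one]
    have hγη (k) : γ (η k) = ∑ i, θ (e k) i * γ (WithLp.toLp r (Pi.single i 1)) := by
      rw [StrongDual.piLp_apply]
    obtain ⟨h1, h2⟩ := hθ _ hγ
    simp only [hγη, ← Finset.sum_mul]
    rw [Equiv.sum_comp e fun ω => ‖∑ i, θ ω i * γ (WithLp.toLp r (Pi.single i 1))‖,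
      Equiv.sum_comp e fun ω => ‖∑ i, θ ω i * γ (WithLp.toLp r (Pi.single i 1))‖ ^ p]
    constructor
    · rw [← mul_assoc, ← div_eq_mul_inv, le_div_iff₀ hcard, one_mul]
      exact h1
    · refine Real.rpow_le_rpow (by positivity) ?_ (by positivity)
      rw [← div_eq_mul_inv, div_le_iff₀ hcard, mul_comm]
      exact h2
  have hall (γ : StrongDual 𝕜 (PiLp r (fun _ : Fin n => 𝕜))) :
      ‖γ‖ ≤ A * ∑ ω, ‖γ (η ω)‖ * (Fintype.card Ω : ℝ)⁻¹ ∧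
      (∑ ω, ‖γ (η ω)‖ ^ p * (Fintype.card Ω : ℝ)⁻¹) ^ (1 / p) ≤ B ^ (1 / p) * ‖γ‖ := by
    set S := ∑ i, ‖γ (WithLp.toLp r (Pi.single i 1))‖ ^ a with hS
    have hS0 : 0 ≤ S := by positivity
    rcases hS0.eq_or_lt with h0 | hpos
    · have hzero : γ = 0 := by
        ext x
        rw [StrongDual.piLp_apply]
        refine Finset.sum_eq_zero fun i _ => ?_
        have := (Finset.sum_eq_zero_iff_of_nonneg fun i _ => by positivity).1 h0.symm i
          (Finset.mem_univ i)
        rw [Real.rpow_eq_zero (norm_nonneg _) ha0.ne', norm_eq_zero] at this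
        rw [this, mul_zero]
      subst hzero
      simp [Real.zero_rpow hp0.ne', Real.zero_rpow (inv_ne_zero hp0.ne')]
    · set t : ℝ := S ^ (1 / a) with ht
      have ht0 : 0 < t := by positivity
      have hta : t ^ a = S := by
        rw [ht, ← Real.rpow_mul hS0, one_div_mul_cancel ha0.ne', Real.rpow_one]
      obtain ⟨δ, hγδ⟩ : ∃ δ, γ = (t : 𝕜) • δ :=
        ⟨(t : 𝕜)⁻¹ • γ, by rw [smul_inv_smul₀ (by exact_mod_cast ht0.ne')]⟩
      have hδn (x) : ‖γ x‖ = t * ‖δ x‖ := by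
        simp [hγδ, abs_of_pos ht0]
      have hδ : ∑ i, ‖δ (WithLp.toLp r (Pi.single i 1))‖ ^ a = 1 := by
        have h1 : S = S * ∑ i, ‖δ (WithLp.toLp r (Pi.single i 1))‖ ^ a := by
          rw [← hta, Finset.mul_sum, hta, hS]
          refine Finset.sum_congr rfl fun i _ => ?_
          rw [hδn, Real.mul_rpow ht0.le (norm_nonneg _), hta]
        exact (mul_eq_left₀ hpos.ne').1 h1.symm
      obtain ⟨h1, h2⟩ := hunit δ hδ
      have hnorm : ‖γ‖ = t * ‖δ‖ := by
        rw [hγδ, norm_smul, RCLike.norm_ofReal, abs_of_pos ht0]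
      simp only [hδn, hnorm]
      constructor
      · calc t * ‖δ‖ ≤ t * (A * ∑ ω, ‖δ (η ω)‖ * (Fintype.card Ω : ℝ)⁻¹) := by gcongr
          _ = _ := by
            simp only [mul_assoc t, ← Finset.mul_sum]
            ring
      · simp only [Real.mul_rpow ht0.le (norm_nonneg _), mul_assoc, ← Finset.mul_sum]
        rw [Real.mul_rpow (by positivity) (by positivity), ← Real.rpow_mul ht0.le,
          mul_one_div_cancel hp0.ne', Real.rpow_one]
        calc _ ≤ t * (B ^ (1 / p) * ‖δ‖) := by gcongr
          _ = _ := by ring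
  exact ⟨_, η, Fintype.card_pos, fun γ => (hall γ).1, fun γ => (hall γ).2⟩

end dual

/-! ### Uniform samplings and the equality of the two classes. -/

/-- The finite-dimensional spaces `ℓ_r^n` have uniform dual samplings in `L_p` if `p < r' < 2` or
`r = 2`. -/
theorem exists_isDualSampling (𝕜 : Type*) [RCLike 𝕜] (r r' : ℝ≥0∞) [Fact (1 ≤ r)]
    (hrr' : ENNReal.HolderConjugate r r') {p : ℝ} (hp : 1 ≤ p)
    (h : (ENNReal.ofReal p < r' ∧ r' < 2) ∨ r = 2) :
    ∃ A B : ℝ, 0 ≤ A ∧ 0 ≤ B ∧ ∀ n : ℕ,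
      ∃ (L : ℕ) (θ : Fin L → PiLp r (fun _ : Fin n => 𝕜)), IsDualSampling 𝕜 p A B θ := by
  rcases h with ⟨hpr, hr2⟩ | rfl
  · have hr'top : r' ≠ ⊤ := (hr2.trans ENNReal.ofNat_lt_top).ne
    have hpa : p < r'.toReal := (ENNReal.ofReal_lt_iff_lt_toReal (by linarith) hr'top).1 hpr
    have ha2 : r'.toReal < 2 := by
      simpa using (ENNReal.toReal_lt_toReal hr'top ENNReal.ofNat_ne_top).2 hr2
    have hrr := hrr'.symm
    have hconj : r'.toReal.HolderConjugate r.toReal :=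
      ENNReal.HolderConjugate.toReal (by linarith)
    obtain ⟨A, B, hA, hB, H⟩ := exists_sampling_of_lt_two 𝕜 hp hpa ha2
    refine ⟨A, B ^ (1 / p), hA, by positivity, fun n => ?_⟩
    obtain ⟨Ω, _, _, θ, hθ⟩ := H n
    exact exists_isDualSampling_of_coeff hp hconj.symm θ hθ
  · have hconj : (2 : ℝ≥0∞).toReal.HolderConjugate 2 := by
      rw [Real.holderConjugate_iff]
      norm_num
    obtain ⟨A, B, hA, hB, H⟩ := exists_sampling_two 𝕜 hp
    refine ⟨A, B ^ (1 / p), hA, by positivity, fun n => ?_⟩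
    obtain ⟨Ω, _, _, θ, hθ⟩ := H n
    exact exists_isDualSampling_of_coeff hp hconj θ hθ

theorem corollary2p8 {𝕜 : Type*} [RCLike 𝕜]
    {X : Type*} [NormedAddCommGroup X] [NormedSpace 𝕜 X] [CompleteSpace X]
    (ι : X →ₗ[𝕜] (ℕ → 𝕜)) (hX : IsBanachSequenceSpace ι)
    (q : ℝ) (hq : 1 ≤ q) (hXq : IsQConcave ι q)
    {E : Type*} [NormedAddCommGroup E] [NormedSpace 𝕜 E]
    (r r' : ℝ≥0∞) [Fact (1 ≤ r)] (hrr' : ENNReal.HolderConjugate r r') (hE : IsLgSpace 𝕜 r E)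
    (m : ℕ) (s : ℝ)
    (hs : (q ≤ s ∧ ENNReal.ofReal s < r' ∧ r' < 2) ∨ (q ≤ s ∧ r = 2)) :
    multipleSumming 𝕜 m E X s = multipleSumming 𝕜 m E X q := by
  have hqs : q ≤ s := by rcases hs with h | h <;> exact h.1
  have hs1 : 1 ≤ s := hq.trans hqs
  have hcond : (ENNReal.ofReal s < r' ∧ r' < 2) ∨ r = 2 := hs.imp And.right And.right
  have hcondq : (ENNReal.ofReal q < r' ∧ r' < 2) ∨ r = 2 :=
    hcond.imp (fun h => ⟨(ENNReal.ofReal_le_ofReal hqs).trans_lt h.1, h.2⟩) id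
  obtain ⟨A, B, hA, hB, H⟩ := exists_isDualSampling 𝕜 r r' hrr' hs1 hcond
  obtain ⟨A', B', hA', hB', H'⟩ := exists_isDualSampling 𝕜 r r' hrr' hq hcondq
  -- From `s` to `q`: samplings in `L_s` and `q`-concavity. From `q` to `s`: samplings in `L_q` and
  -- the derived `s`-concavity.
  exact Set.Subset.antisymm (multipleSumming_subset hX hs1 hq hA hB hXq hE H m)
    (multipleSumming_subset hX hq hs1 hA' hB' (hXq.mono hX hq hqs) hE H' m)
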